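/- **Conventions.** Let $\mathcal A=\{x+\sigma y:\ x,y\in\mathbb R\}$, $\sigma^2=1$, be the algebra of Lorentz numbers (oriented by $(1,\sigma)$), and let $\mathbb H^{\mathcal A}$ be the quaternions $\xi=a_0 1+a_1I+a_2J+a_3K$ with coefficients $a_i\in\mathcal A$. Put $H(\xi,\xi')=\sum_i a_ia_i'\in\mathcal A$ and $\hat\xi=\overline{a_0}1+\overline{a_1}I+\overline{a_2}J+\overline{a_3}K$, where $\overline{x+\sigma y}=x-\sigma y$. Let $Spin(4)=S^3_{\mathcal A}=\{q\in\mathbb H^{\mathcal A}: H(q,q)=1\}$, acting on $\mathbb R^4=\{\sigma x_0 1+x_1I+x_2J+x_3K\}\subset\mathbb H^{\mathcal A}$ by $\xi\mapsto q\xi\hat q^{-1}$. The spinor bundle of $\mathbb R^4$ is associated with the bundle of spin frames and with the action of $Spin(4)$ on $\mathbb H^{\mathcal A}$ by left multiplication. The operator $\sigma$ acts on bivectors of $\mathbb R^4$ as the Hodge star. The functions $\cos$ and $\sin$ on $\mathcal A$ are defined by their usual power series. A Lorentz structure on a surface is a field of endomorphisms $\sigma$ of its tangent planes which is the multiplication by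 $\sigma$ in suitable $\mathcal A$-valued local coordinates around every point. A smooth map $f$ is conformal if $df(\sigma u)=\sigma\,df(u)$. **Hypotheses.** Let $M$ be a simply connected oriented smooth surface and $F:M\to\mathbb R^4$ a smooth immersion. Assume that $M$ (with the induced metric) and its normal bundle are flat, so that there are global, smooth, positively oriented, orthonormal, parallel frames $(e_0,e_1)$ of the normal bundle and $(e_2,e_3)$ of $TM$; fix such frames. (The normal bundle is oriented so that a positive normal frame followed by a positive tangent frame is positive in $\mathbb R^4$.) Assume that the oriented Gauss map $G:M\to\Lambda^2\mathbb R^4$, $G(p)=u_1\wedge u_2$ for any positive orthonormal basis $(u_1,u_2)$ of $T_pM$ (viewed in $\mathbb R^4$), is regular, i.e. $dG_p$ is injective for every $p$. Let $g:M\to\mathbb H^{\mathcal A}$ represent the constant spinor field $1$ of $\mathbb R^4$ in a smooth spin frame field $\tilde s$ of $\mathbb R^4$ along $M$ lying above $(e_0,e_1,e_2,e_3)$, i.e. $1_{|M}=[\tilde s,g]$. **Theorem.** There is a unique Lorentz structure $\sigma$ on $M$ such that $dG(\sigma u)=\sigma\,dG(u)$ for all tangent vectors $u$. With this structure: 1.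 $g$ takes its values in $S^3_{\mathcal A}$ and is a conformal map. At each point of $M$ there is a local chart $a:\mathcal U\subset\mathcal A\to M$ (a diffeomorphism from an open set onto an open neighbourhood of the point), compatible with the orientation of $M$, such that $dg=g'\,da$ in this chart for a function $g':\mathcal U\to\mathbb H^{\mathcal A}$ with $H(g',g')\equiv1$. Every such chart is compatible with the Lorentz structure. These charts are unique up to the maps $z\mapsto\pm z+b$, $b\in\mathcal A$: on every connected subset of their common image, the coordinates given by two such charts differ by one map of this form, and conversely applying such a map to the coordinates of such a chart (possibly restricted to a smaller open set) gives again such a chart. 2. For every such chart $a:\mathcal U\to M$ there is a conformal map $\psi:\mathcal U\to\mathcal A$ such that $g'g^{-1}=\cos\psi\,J+\sin\psi\,K$ on $\mathcal U$. -/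

import Mathlib

open scoped Manifold ContDiff Quaternion

noncomputable section

/-! ### Lorentz numbers and quaternions over them -/

/-- The Lorentz numbers `x + σ y` (`x, y` real, `σ ^ 2 = 1`): `x` is the component `re` and `y` is
the component `im`. -/
abbrev LorentzNum : Type := QuadraticAlgebra ℝ 1 0

/-- The quaternions `a₀ 1 + a₁ I + a₂ J + a₃ K` with coefficients in the Lorentz numbers. -/
abbrev LorentzQuat : Type := Quaternion LorentzNum

/-- The Lorentz number `σ`. -/
def lsig : LorentzNum := ⟨0, 1⟩

theorem lsig_mul_lsig : lsig * lsig = 1 := by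
  apply QuadraticAlgebra.ext
  · change (0 : ℝ) * 0 + 1 * 1 * 1 = 1
    norm_num
  · change (0 : ℝ) * 1 + 1 * 0 + 0 * 1 * 1 = 0
    norm_num

/-- The coordinates `(x, y)` of the Lorentz number `x + σ y`. -/
def LorentzNum.coords : LorentzNum →ₗ[ℝ] ℝ × ℝ where
  toFun a := (a.re, a.im)
  map_add' _ _ := rfl
  map_smul' _ _ := rfl

theorem LorentzNum.coords_injective : Function.Injective LorentzNum.coords := by
  intro a b h
  have h' := Prod.ext_iff.1 h
  exact QuadraticAlgebra.ext h'.1 h'.2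

/- The Lorentz numbers carry the topology of `ℝ²` and their quaternions that of `ℝ⁸`; the norms
below only serve to fix these topologies and to differentiate. -/
instance LorentzNum.instNormedAddCommGroup : NormedAddCommGroup LorentzNum :=
  NormedAddCommGroup.induced LorentzNum (ℝ × ℝ) LorentzNum.coords LorentzNum.coords_injective

instance LorentzNum.instNormedSpace : NormedSpace ℝ LorentzNum :=
  NormedSpace.induced ℝ LorentzNum (ℝ × ℝ) LorentzNum.coords

/-- The coefficients `(a₀, a₁, a₂, a₃)` of the quaternion `a₀ 1 + a₁ I + a₂ J + a₃ K`. -/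
def LorentzQuat.coords :
    LorentzQuat →ₗ[ℝ] LorentzNum × LorentzNum × LorentzNum × LorentzNum where
  toFun q := (q.re, q.imI, q.imJ, q.imK)
  map_add' _ _ := rfl
  map_smul' _ _ := rfl

theorem LorentzQuat.coords_injective : Function.Injective LorentzQuat.coords := by
  intro a b h
  have h₁ := Prod.ext_iff.1 h
  have h₂ := Prod.ext_iff.1 h₁.2
  have h₃ := Prod.ext_iff.1 h₂.2
  exact QuaternionAlgebra.ext h₁.1 h₂.1 h₃.1 h₃.2

instance LorentzQuat.instNormedAddCommGroup : NormedAddCommGroup LorentzQuat :=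
  NormedAddCommGroup.induced LorentzQuat (LorentzNum × LorentzNum × LorentzNum × LorentzNum)
    LorentzQuat.coords LorentzQuat.coords_injective

instance LorentzQuat.instNormedSpace : NormedSpace ℝ LorentzQuat :=
  NormedSpace.induced ℝ LorentzQuat (LorentzNum × LorentzNum × LorentzNum × LorentzNum)
    LorentzQuat.coords

/-- The unit quaternion `I`. -/
def qI : LorentzQuat := ⟨0, 1, 0, 0⟩

/-- The unit quaternion `J`. -/
def qJ : LorentzQuat := ⟨0, 0, 1, 0⟩

/-- The unit quaternion `K`. -/
def qK : LorentzQuat := ⟨0, 0, 0, 1⟩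

/-- The conjugate `x - σ y` of the Lorentz number `x + σ y`. -/
def lconj (a : LorentzNum) : LorentzNum := ⟨a.re, -a.im⟩

/-- The map `ξ ↦ ξ̂` conjugating each of the four coefficients of a quaternion. -/
def qhat (ξ : LorentzQuat) : LorentzQuat := ⟨lconj ξ.re, lconj ξ.imI, lconj ξ.imJ, lconj ξ.imK⟩

/-- The bilinear form `H(ξ, ξ') = a₀ a₀' + a₁ a₁' + a₂ a₂' + a₃ a₃'`, with values in the Lorentz
numbers. -/
def formH (ξ ξ' : LorentzQuat) : LorentzNum :=
  ξ.re * ξ'.re + ξ.imI * ξ'.imI + ξ.imJ * ξ'.imJ + ξ.imK * ξ'.imK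

/-- The cosine of a Lorentz number; `hasSum_lcos` shows that it is the sum of the cosine series. -/
def lcos (θ : LorentzNum) : LorentzNum :=
  ⟨(Real.cos (θ.re + θ.im) + Real.cos (θ.re - θ.im)) / 2,
    (Real.cos (θ.re + θ.im) - Real.cos (θ.re - θ.im)) / 2⟩

/-- The sine of a Lorentz number; `hasSum_lsin` shows that it is the sum of the sine series. -/
def lsin (θ : LorentzNum) : LorentzNum :=
  ⟨(Real.sin (θ.re + θ.im) + Real.sin (θ.re - θ.im)) / 2,
    (Real.sin (θ.re + θ.im) - Real.sin (θ.re - θ.im)) / 2⟩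

theorem LorentzNum.pow_re_im (θ : LorentzNum) (n : ℕ) :
    (θ ^ n).re = ((θ.re + θ.im) ^ n + (θ.re - θ.im) ^ n) / 2 ∧
      (θ ^ n).im = ((θ.re + θ.im) ^ n - (θ.re - θ.im) ^ n) / 2 := by
  induction n with
  | zero =>
    rw [pow_zero]
    change (1 : ℝ) = _ ∧ (0 : ℝ) = _
    norm_num
  | succ n ih =>
    rw [pow_succ, QuadraticAlgebra.re_mul, QuadraticAlgebra.im_mul, ih.1, ih.2]
    constructor <;> ring

theorem LorentzNum.isInducing_coords : Topology.IsInducing LorentzNum.coords := ⟨rfl⟩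

theorem LorentzNum.hasSum_iff (f : ℕ → LorentzNum) (a : LorentzNum) :
    HasSum f a ↔ HasSum (fun n => (f n).re) a.re ∧ HasSum (fun n => (f n).im) a.im := by
  rw [← LorentzNum.isInducing_coords.hasSum_iff]
  constructor
  · intro h
    exact ⟨h.map (AddMonoidHom.fst ℝ ℝ) continuous_fst,
      h.map (AddMonoidHom.snd ℝ ℝ) continuous_snd⟩
  · rintro ⟨h₁, h₂⟩
    exact h₁.prodMk h₂

theorem hasSum_lcos (θ : LorentzNum) :
    HasSum (fun n : ℕ => ((-1 : ℝ) ^ n / ((2 * n).factorial : ℝ)) • θ ^ (2 * n)) (lcos θ) := by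
  have h₁ := Real.hasSum_cos (θ.re + θ.im)
  have h₂ := Real.hasSum_cos (θ.re - θ.im)
  rw [LorentzNum.hasSum_iff]
  refine ⟨((h₁.add h₂).div_const 2).congr_fun ?_, ((h₁.sub h₂).div_const 2).congr_fun ?_⟩ <;>
  · intro n
    simp only [QuadraticAlgebra.re_smul, QuadraticAlgebra.im_smul, smul_eq_mul,
      (LorentzNum.pow_re_im θ _).1, (LorentzNum.pow_re_im θ _).2]
    ring

theorem hasSum_lsin (θ : LorentzNum) :
    HasSum (fun n : ℕ => ((-1 : ℝ) ^ n / ((2 * n + 1).factorial : ℝ)) • θ ^ (2 * n + 1))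
      (lsin θ) := by
  have h₁ := Real.hasSum_sin (θ.re + θ.im)
  have h₂ := Real.hasSum_sin (θ.re - θ.im)
  rw [LorentzNum.hasSum_iff]
  refine ⟨((h₁.add h₂).div_const 2).congr_fun ?_, ((h₁.sub h₂).div_const 2).congr_fun ?_⟩ <;>
  · intro n
    simp only [QuadraticAlgebra.re_smul, QuadraticAlgebra.im_smul, smul_eq_mul,
      (LorentzNum.pow_re_im θ _).1, (LorentzNum.pow_re_im θ _).2]
    ring

/-! ### The spin group and the constant spinor field of `ℝ⁴` -/

/-- Euclidean space of dimension four. -/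
abbrev R4 : Type := EuclideanSpace ℝ (Fin 4)

/-- The embedding `(x₀, x₁, x₂, x₃) ↦ σ x₀ 1 + x₁ I + x₂ J + x₃ K` of `ℝ⁴`. -/
def cliff (x : R4) : LorentzQuat := ⟨⟨0, x 0⟩, ⟨x 1, 0⟩, ⟨x 2, 0⟩, ⟨x 3, 0⟩⟩

/-- `Spin(4)`, the unit sphere `H(q, q) = 1` of the quaternions over the Lorentz numbers. -/
def Spin4 : Type := {q : LorentzQuat // formH q q = 1}

instance : CoeOut Spin4 LorentzQuat := ⟨Subtype.val⟩

/-- The unit of `Spin(4)`. -/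
def Spin4.unit : Spin4 := ⟨1, by simp [formH]⟩

/-- The spin frame `q` of `ℝ⁴` (that is, `q` times the canonical spin frame) lies above the frame
`v` of `ℝ⁴`: the rotation `ξ ↦ q ξ q̂⁻¹` maps the canonical basis to `v`. -/
def Spin4.IsAbove (q : Spin4) (v : Fin 4 → R4) : Prop :=
  ∀ i, cliff (v i) = q.1 * cliff (EuclideanSpace.single i 1) * Ring.inverse (qhat q.1)

/-- `(s, ξ) ∼ (s a, a⁻¹ ξ)` for `a` in `Spin(4)`. -/
def spinorRel (u v : Spin4 × LorentzQuat) : Prop :=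
  ∃ a : Spin4, v.1.1 = u.1.1 * a.1 ∧ u.2 = a.1 * v.2

/-- The fibre of the spinor bundle of `ℝ⁴`, associated with the bundle of spin frames and with the
representation of `Spin(4)` on the quaternions by left multiplication. -/
def Spinor : Type := Quot spinorRel

/-- The spinor `[s, ξ]` with coordinate `ξ` in the spin frame `s`. -/
def Spinor.mk (s : Spin4) (ξ : LorentzQuat) : Spinor := Quot.mk _ (s, ξ)

/-- The value at each point of the constant spinor field `1` of `ℝ⁴`, whose coordinate in the
canonical spin frame is `1`. -/
def constSpinor : Spinor := Spinor.mk Spin4.unit 1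

/-! ### Bivectors of `ℝ⁴` -/

/-- Bivectors of `ℝ⁴`, given by their components in the `eᵢ ∧ eⱼ` (an antisymmetric array). -/
abbrev Bivec : Type := Fin 4 → Fin 4 → ℝ

/-- The bivector `u ∧ v`. -/
def wedge (u v : R4) : Bivec := fun i j => u i * v j - u j * v i

/-- The Hodge star operator on the bivectors of `ℝ⁴`. -/
def hodge (η : Bivec) : Bivec :=
  ![![0, η 2 3, η 3 1, η 1 2],
    ![η 3 2, 0, η 0 3, η 2 0],
    ![η 1 3, η 3 0, 0, η 0 1],
    ![η 2 1, η 0 2, η 1 0, 0]]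

/-- `⟨*η, η'⟩ = η ∧ η'` for simple bivectors (so for all), the scalar product being half the sum of
the products of all the components. -/
theorem hodge_wedge (u v u' v' : R4) :
    (∑ i, ∑ j, hodge (wedge u v) i j * wedge u' v' i j) / 2 =
      Matrix.det (Matrix.of ![u.ofLp, v.ofLp, u'.ofLp, v'.ofLp]) := by
  simp [Matrix.det_succ_row_zero, Fin.sum_univ_succ, hodge, wedge, Fin.succAbove,
    Matrix.of_apply]
  ring

/-! ### Surfaces, orientations, charts and Lorentz structures -/

/-- The model space of surfaces. -/
abbrev R2 : Type := EuclideanSpace ℝ (Fin 2)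

/-- `(u, v)` is a basis belonging to the orientation `o` of a plane. -/
def IsPositivePair {V : Type*} [AddCommGroup V] [Module ℝ V]
    (o : Orientation ℝ V (Fin 2)) (u v : V) : Prop :=
  ∃ b : Module.Basis (Fin 2) ℝ V, b 0 = u ∧ b 1 = v ∧ b.orientation = o

/-- `f' = df / da`: the differential of `f` at `z` is `h ↦ h f'`, with the product by Lorentz
numbers. -/
def HasLorentzDerivAt {V : Type*} [NormedAddCommGroup V] [NormedSpace ℝ V] [Module LorentzNum V]
    (f : LorentzNum → V) (f' : V) (z : LorentzNum) : Prop :=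
  ∃ L : LorentzNum →L[ℝ] V, HasFDerivAt f L z ∧ ∀ h, L h = h • f'

/-- The derivative `f'`: the only possible value of `f'` in `HasLorentzDerivAt f f' z`. -/
def lorentzDeriv {V : Type*} [NormedAddCommGroup V] [NormedSpace ℝ V]
    (f : LorentzNum → V) (z : LorentzNum) : V :=
  fderiv ℝ f z 1

theorem HasLorentzDerivAt.eq_lorentzDeriv {V : Type*} [NormedAddCommGroup V] [NormedSpace ℝ V]
    [Module LorentzNum V] {f : LorentzNum → V} {f' : V} {z : LorentzNum}
    (h : HasLorentzDerivAt f f' z) : f' = lorentzDeriv f z := by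
  obtain ⟨L, hL, hf⟩ := h
  rw [lorentzDeriv, hL.fderiv, hf, one_smul]

section Surfaces

variable {M : Type*} [TopologicalSpace M] [ChartedSpace R2 M]

/-- A smooth chart `a : 𝒰 ⊆ 𝒜 → M`: a diffeomorphism from an open set of Lorentz numbers (its
`source`) onto an open subset of `M` (its `target`). -/
def IsSmoothChart (a : OpenPartialHomeomorph LorentzNum M) : Prop :=
  ContMDiffOn 𝓘(ℝ, LorentzNum) 𝓘(ℝ, R2) ∞ a a.source ∧
    ContMDiffOn 𝓘(ℝ, R2) 𝓘(ℝ, LorentzNum) ∞ a.symm a.target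

/-- The differential of a chart `a`, applied to the vector `h`. -/
def chartDeriv (a : OpenPartialHomeomorph LorentzNum M) (z h : LorentzNum) :
    TangentSpace 𝓘(ℝ, R2) (a z) :=
  mfderiv 𝓘(ℝ, LorentzNum) 𝓘(ℝ, R2) a z h

/-- The chart `a` maps the orientation `(1, σ)` of the Lorentz numbers to `o`. -/
def PreservesOrientation (o : ∀ p : M, Orientation ℝ (TangentSpace 𝓘(ℝ, R2) p) (Fin 2))
    (a : OpenPartialHomeomorph LorentzNum M) : Prop :=
  ∀ z ∈ a.source, IsPositivePair (o (a z)) (chartDeriv a z 1) (chartDeriv a z lsig)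

variable (M) in
/-- An orientation of the surface `M`: orientations of the tangent planes, coming from charts. -/
structure SurfaceOrientation where
  /-- the orientation of each tangent plane -/
  toFun : ∀ p : M, Orientation ℝ (TangentSpace 𝓘(ℝ, R2) p) (Fin 2)
  exists_chart : ∀ p, ∃ a : OpenPartialHomeomorph LorentzNum M,
    p ∈ a.target ∧ IsSmoothChart a ∧ PreservesOrientation toFun a

/-- The chart `a` carries the multiplication by `σ` to the family of endomorphisms `S`. -/
def IsCompatibleChart (S : ∀ p : M, TangentSpace 𝓘(ℝ, R2) p →ₗ[ℝ] TangentSpace 𝓘(ℝ, R2) p)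
    (a : OpenPartialHomeomorph LorentzNum M) : Prop :=
  IsSmoothChart a ∧ ∀ z ∈ a.source, ∀ h, S (a z) (chartDeriv a z h) = chartDeriv a z (lsig * h)

variable (M) in
/-- A Lorentz structure on the surface `M`: endomorphisms `σ` of the tangent planes which are the
multiplication by `σ` in suitable charts around every point. (The transition maps between such
charts commute with `σ`, and conversely an atlas whose transition maps commute with `σ` gives such a
family of endomorphisms.) -/
structure LorentzStructure where
  /-- the endomorphism `σ` of each tangent plane -/
  toFun : ∀ p : M, TangentSpace 𝓘(ℝ, R2) p →ₗ[ℝ] TangentSpace 𝓘(ℝ, R2) p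
  exists_chart : ∀ p, ∃ a : OpenPartialHomeomorph LorentzNum M,
    p ∈ a.target ∧ IsCompatibleChart toFun a

/-- The Lorentz structure is induced by `G`: `dG (σ u) = σ dG u`, where `σ` acts on bivectors as
the Hodge star. -/
def LorentzStructure.IsInducedBy (S : LorentzStructure M) (G : M → Bivec) : Prop :=
  ∀ p (u : TangentSpace 𝓘(ℝ, R2) p),
    mfderiv 𝓘(ℝ, R2) 𝓘(ℝ, Bivec) G p (S.toFun p u) =
      hodge (mfderiv 𝓘(ℝ, R2) 𝓘(ℝ, Bivec) G p u)

/-- The map `g`, with values in the quaternions over the Lorentz numbers, is conformal: it is smooth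
and `dg (σ u) = σ dg u`. -/
def LorentzStructure.IsConformal (S : LorentzStructure M) (g : M → LorentzQuat) : Prop :=
  ContMDiff 𝓘(ℝ, R2) 𝓘(ℝ, LorentzQuat) ∞ g ∧ ∀ p (u : TangentSpace 𝓘(ℝ, R2) p),
    mfderiv 𝓘(ℝ, R2) 𝓘(ℝ, LorentzQuat) g p (S.toFun p u) =
      HSMul.hSMul (β := LorentzQuat) lsig (mfderiv 𝓘(ℝ, R2) 𝓘(ℝ, LorentzQuat) g p u)

/-- A smooth chart `a : 𝒰 ⊆ 𝒜 → M`, compatible with the orientation of `M`, in which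
`dg = g' da` for a function `g'` with `H(g', g') = 1`. -/
def IsArcLengthChart (o : SurfaceOrientation M) (g : M → LorentzQuat)
    (a : OpenPartialHomeomorph LorentzNum M) : Prop :=
  IsSmoothChart a ∧ PreservesOrientation o.toFun a ∧ ∀ z ∈ a.source,
    HasLorentzDerivAt (g ∘ a) (lorentzDeriv (g ∘ a) z) z ∧
      formH (lorentzDeriv (g ∘ a) z) (lorentzDeriv (g ∘ a) z) = 1

/-! ### Immersed surfaces in `ℝ⁴` -/

/-- The differential of a map into `ℝ⁴`, as a vector of `ℝ⁴`. -/
def dR4 (f : M → R4) (p : M) (u : TangentSpace 𝓘(ℝ, R2) p) : R4 :=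
  mfderiv 𝓘(ℝ, R2) 𝓘(ℝ, R4) f p u

/-- `F` is a smooth immersion. -/
def IsSmoothImmersion (F : M → R4) : Prop :=
  ContMDiff 𝓘(ℝ, R2) 𝓘(ℝ, R4) ∞ F ∧ ∀ p, Function.Injective (dR4 F p)

/-- `ν` is normal to the immersed surface at `p`. -/
def IsNormalTo (F : M → R4) (p : M) (ν : R4) : Prop :=
  ∀ u : TangentSpace 𝓘(ℝ, R2) p, inner ℝ ν (dR4 F p u) = 0

/-- `(e₀, e₁)` and `(e₂, e₃)` are positively oriented orthonormal frames, normal and tangent to the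
surface immersed by `F`, and parallel: the normal components of `de₀, de₁` and the tangent
components of `de₂, de₃` vanish. The normal planes are oriented so that a positive normal frame
followed by a positive tangent frame is a positive basis of `ℝ⁴`. -/
structure IsParallelFrame (o : SurfaceOrientation M) (F : M → R4) (e : Fin 4 → M → R4) :
    Prop where
  smooth : ∀ i, ContMDiff 𝓘(ℝ, R2) 𝓘(ℝ, R4) ∞ (e i)
  orthonormal : ∀ p, Orthonormal ℝ (fun i => e i p)
  normal : ∀ p, IsNormalTo F p (e 0 p) ∧ IsNormalTo F p (e 1 p)
  tangent : ∀ p, ∃ u v : TangentSpace 𝓘(ℝ, R2) p,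
    dR4 F p u = e 2 p ∧ dR4 F p v = e 3 p ∧ IsPositivePair (o.toFun p) u v
  positive : ∀ p, 0 < Matrix.det (Matrix.of fun i j => e i p j)
  parallel_normal : ∀ p (u : TangentSpace 𝓘(ℝ, R2) p) (ν : R4), IsNormalTo F p ν →
    inner ℝ (dR4 (e 0) p u) ν = 0 ∧ inner ℝ (dR4 (e 1) p u) ν = 0
  parallel_tangent : ∀ p (u v : TangentSpace 𝓘(ℝ, R2) p),
    inner ℝ (dR4 (e 2) p u) (dR4 F p v) = 0 ∧ inner ℝ (dR4 (e 3) p u) (dR4 F p v) = 0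

/-- `G` is the oriented Gauss map of the surface immersed by `F`: at each point, `G` is the
bivector `u₁ ∧ u₂` of every positively oriented orthonormal basis of the tangent plane. -/
def IsGaussMap (o : SurfaceOrientation M) (F : M → R4) (G : M → Bivec) : Prop :=
  ∀ p (u v : TangentSpace 𝓘(ℝ, R2) p), IsPositivePair (o.toFun p) u v →
    Orthonormal ℝ ![dR4 F p u, dR4 F p v] → G p = wedge (dR4 F p u) (dR4 F p v)

/-- `g` represents the constant spinor field `1` of `ℝ⁴`, restricted to the surface, in a smooth
spin frame field `s` above the frame field `e`. -/
def RepresentsConstSpinor (e : Fin 4 → M → R4) (g : M → LorentzQuat) : Prop :=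
  ∃ s : M → Spin4, ContMDiff 𝓘(ℝ, R2) 𝓘(ℝ, LorentzQuat) ∞ (fun p => (s p).1) ∧
    (∀ p, (s p).IsAbove (fun i => e i p)) ∧ ∀ p, Spinor.mk (s p) (g p) = constSpinor

end Surfaces

end

noncomputable section

/-! ### Algebra of Lorentz numbers and quaternions -/

/-! The coordinate of the spinor field `1` in the spin frame `s` is `g = s⁻¹`, so the frame is
recovered as `e_i = g⁻¹ E_i ĝ`, with `E_i` the canonical basis, and all the geometry sits in the
logarithmic derivative `Θ = dg g⁻¹`. Its real part vanishes because `H(g, g) = 1`. Its `I` component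
encodes the two connection forms: the tangent connection is its real part, the normal connection its
`σ` part. Both vanish for parallel frames (`imI_logDeriv`), so `Θ = η J + ζ K` with `η`, `ζ`
one-forms valued in the Lorentz numbers.

The bivector `e₂ ∧ e₃` corresponds to `g⁻¹ I g`, the Hodge star to multiplication by `σ`, and
differentiation gives `dG = 2 g⁻¹ I dg`. Hence `dG` and `dg` have the same kernel and the same
endomorphism `σ` (`IsGaussSpinor.hodge_iff`). From there on only `g` matters, and regularity of `G`
becomes injectivity of `dg`.

The Maurer–Cartan equation says that `η` and `ζ` are closed and, read along `I`, that `η ∧ ζ = 0`.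
The characters `plus` and `minus` split the Lorentz numbers into two copies of `ℝ`, and each copy
carries a pair of closed, proportional real forms. Such a pair is `β dw`, `γ dw` with `β² + γ² = 1`
(`exists_arcLength_potential`). The two potentials `w`, one of them up to a sign fixing the
orientation, form a Lorentz-valued coordinate in which `dg = g' dw` and `H(g', g') = 1`.
Multiplication by `σ` in this coordinate is the required structure; it is unique because `dg` is
injective.

Between two such charts `g'` changes by a factor `c` with `c² = 1`, so `c` is `±1` or `±σ`; the
orientation excludes `±σ`. The transition maps therefore have derivative `±1` and are locally `z ↦
±z + b`.

For the angle, `g' g⁻¹` is defined on `M` only up to sign, but under each character its square is a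
well-defined circle-valued function on the simply connected `M`, so it has a global argument. Half
of it, corrected by `0` or `π`, gives an angle on the whole domain of any arc length chart, whatever
the topology of that domain. The angle is conformal since `dψ = β dγ - γ dβ`, where `g' g⁻¹ = β J +
γ K` has a derivative linear over the Lorentz numbers. -/

instance LorentzQuat.instFiniteDimensional : FiniteDimensional ℝ LorentzQuat :=
  FiniteDimensional.of_injective LorentzQuat.coords LorentzQuat.coords_injective

namespace LorentzNum

/-- The ring homomorphism `x + σ y ↦ x + y`. -/
def plus : LorentzNum →L[ℝ] ℝ :=
  LinearMap.toContinuousLinearMap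
    { toFun := fun a => a.re + a.im
      map_add' := fun a b => by simp; ring
      map_smul' := fun r a => by simp; ring }

/-- The ring homomorphism `x + σ y ↦ x - y`. -/
def minus : LorentzNum →L[ℝ] ℝ :=
  LinearMap.toContinuousLinearMap
    { toFun := fun a => a.re - a.im
      map_add' := fun a b => by simp; ring
      map_smul' := fun r a => by simp; ring }

@[simp] theorem re_one' : (1 : LorentzNum).re = 1 := rfl

@[simp] theorem im_one' : (1 : LorentzNum).im = 0 := rfl

theorem plus_apply (a : LorentzNum) : plus a = a.re + a.im := rfl

theorem minus_apply (a : LorentzNum) : minus a = a.re - a.im := rfl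

theorem plus_mul (a b : LorentzNum) : plus (a * b) = plus a * plus b := by
  simp [plus_apply]; ring

theorem minus_mul (a b : LorentzNum) : minus (a * b) = minus a * minus b := by
  simp [minus_apply]; ring

@[simp] theorem plus_one : plus 1 = 1 := by simp [plus_apply]

@[simp] theorem minus_one : minus 1 = 1 := by simp [minus_apply]

theorem ext_plus_minus {a b : LorentzNum} (h₁ : plus a = plus b) (h₂ : minus a = minus b) :
    a = b := by
  rw [plus_apply, plus_apply] at h₁
  rw [minus_apply, minus_apply] at h₂
  exact QuadraticAlgebra.ext (by linarith) (by linarith)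

/-- The Lorentz number with given images under `plus` and `minus`. -/
def ofPair : ℝ × ℝ →L[ℝ] LorentzNum :=
  LinearMap.toContinuousLinearMap
    { toFun := fun x => ⟨(x.1 + x.2) / 2, (x.1 - x.2) / 2⟩
      map_add' := fun a b => by ext <;> simp <;> ring
      map_smul' := fun r a => by ext <;> simp <;> ring }

theorem ofPair_apply (x : ℝ × ℝ) : ofPair x = ⟨(x.1 + x.2) / 2, (x.1 - x.2) / 2⟩ := rfl

@[simp] theorem plus_ofPair (x : ℝ × ℝ) : plus (ofPair x) = x.1 := by
  simp [plus_apply, ofPair_apply]; ring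

@[simp] theorem minus_ofPair (x : ℝ × ℝ) : minus (ofPair x) = x.2 := by
  simp [minus_apply, ofPair_apply]; ring

theorem plus_lcos (a : LorentzNum) : plus (lcos a) = Real.cos (plus a) := by
  simp [plus_apply, lcos]; ring

theorem minus_lcos (a : LorentzNum) : minus (lcos a) = Real.cos (minus a) := by
  simp [minus_apply, lcos]; ring

theorem plus_lsin (a : LorentzNum) : plus (lsin a) = Real.sin (plus a) := by
  simp [plus_apply, lsin]; ring

theorem minus_lsin (a : LorentzNum) : minus (lsin a) = Real.sin (minus a) := by
  simp [minus_apply, lsin]; ring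

theorem eq_add_smul_lsig (a : LorentzNum) : a = a.re • (1 : LorentzNum) + a.im • lsig := by
  ext <;> simp [lsig]

end LorentzNum

namespace LorentzQuat

theorem mul_star_of_formH {q : LorentzQuat} (h : formH q q = 1) : q * star q = 1 := by
  unfold formH at h
  ext1 <;> simp <;> first | linear_combination h | ring

theorem star_mul_of_formH {q : LorentzQuat} (h : formH q q = 1) : star q * q = 1 := by
  unfold formH at h
  ext1 <;> simp <;> first | linear_combination h | ring

theorem formH_mul (p q : LorentzQuat) : formH (p * q) (p * q) = formH p p * formH q q := by
  simp [formH]; ring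

theorem formH_star (p : LorentzQuat) : formH (star p) (star p) = formH p p := by
  simp [formH]

theorem formH_smul (a : LorentzNum) (p : LorentzQuat) :
    formH (a • p) (a • p) = a * a * formH p p := by
  simp [formH]; ring

theorem lconj_add (a b : LorentzNum) : lconj (a + b) = lconj a + lconj b := by
  ext <;> simp [lconj]; ring

theorem lconj_mul (a b : LorentzNum) : lconj (a * b) = lconj a * lconj b := by
  ext <;> simp [lconj]; ring

theorem lconj_neg (a : LorentzNum) : lconj (-a) = -lconj a := by
  ext <;> simp [lconj]

theorem lconj_sub (a b : LorentzNum) : lconj (a - b) = lconj a - lconj b := by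
  rw [sub_eq_add_neg, lconj_add, lconj_neg, sub_eq_add_neg]

@[simp] theorem re_qhat (q : LorentzQuat) : (qhat q).re = lconj q.re := rfl
@[simp] theorem imI_qhat (q : LorentzQuat) : (qhat q).imI = lconj q.imI := rfl
@[simp] theorem imJ_qhat (q : LorentzQuat) : (qhat q).imJ = lconj q.imJ := rfl
@[simp] theorem imK_qhat (q : LorentzQuat) : (qhat q).imK = lconj q.imK := rfl

@[simp] theorem re_cliff (x : R4) : (cliff x).re = ⟨0, x 0⟩ := rfl
@[simp] theorem imI_cliff (x : R4) : (cliff x).imI = ⟨x 1, 0⟩ := rfl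
@[simp] theorem imJ_cliff (x : R4) : (cliff x).imJ = ⟨x 2, 0⟩ := rfl
@[simp] theorem imK_cliff (x : R4) : (cliff x).imK = ⟨x 3, 0⟩ := rfl

theorem qhat_mul (p q : LorentzQuat) : qhat (p * q) = qhat p * qhat q := by
  ext1 <;> simp [lconj_add, lconj_mul, lconj_sub]

theorem qhat_star (p : LorentzQuat) : qhat (star p) = star (qhat p) := by
  ext1 <;> simp [lconj_neg]

theorem re_mul_comm (p q : LorentzQuat) : (p * q).re = (q * p).re := by
  simp; ring

theorem smul_mul (a : LorentzNum) (p q : LorentzQuat) : (a • p) * q = a • (p * q) := by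
  ext1 <;> simp <;> ring

theorem mul_smul' (a : LorentzNum) (p q : LorentzQuat) : p * (a • q) = a • (p * q) := by
  ext1 <;> simp <;> ring

theorem star_smul' (a : LorentzNum) (p : LorentzQuat) : star (a • p) = a • star p := by
  ext1 <;> simp

/-- Multiplication of quaternions as a continuous bilinear map. -/
def mulL : LorentzQuat →L[ℝ] LorentzQuat →L[ℝ] LorentzQuat :=
  LinearMap.toContinuousBilinearMap
    (LinearMap.mk₂ ℝ (fun p q : LorentzQuat => p * q)
      (fun _ _ _ => add_mul _ _ _) (fun r p q => by ext1 <;> simp [smul_add, smul_sub])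
      (fun _ _ _ => mul_add _ _ _)
      (fun r p q => by ext1 <;> simp [smul_add, smul_sub]))

@[simp] theorem mulL_apply (p q : LorentzQuat) : mulL p q = p * q := rfl

/-- Multiplication of quaternions by Lorentz numbers as a continuous bilinear map. -/
def smulL : LorentzNum →L[ℝ] LorentzQuat →L[ℝ] LorentzQuat :=
  LinearMap.toContinuousBilinearMap
    (LinearMap.mk₂ ℝ (fun (a : LorentzNum) (q : LorentzQuat) => a • q)
      (fun _ _ _ => add_smul _ _ _) (fun _ _ _ => smul_assoc _ _ _)
      (fun _ _ _ => smul_add _ _ _) (fun _ _ _ => smul_comm _ _ _))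

@[simp] theorem smulL_apply (a : LorentzNum) (q : LorentzQuat) : smulL a q = a • q := rfl

/-- Quaternionic conjugation as a continuous linear map. -/
def starL : LorentzQuat →L[ℝ] LorentzQuat :=
  LinearMap.toContinuousLinearMap
    { toFun := fun q => star q
      map_add' := fun p q => star_add p q
      map_smul' := fun r q => by ext1 <;> simp }

@[simp] theorem starL_apply (q : LorentzQuat) : starL q = star q := rfl

/-- The map `qhat` as a continuous linear map. -/
def hatL : LorentzQuat →L[ℝ] LorentzQuat :=
  LinearMap.toContinuousLinearMap
    { toFun := qhat
      map_add' := fun p q => by ext1 <;> simp [lconj_add]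
      map_smul' := fun r q => by ext <;> simp [lconj] }

@[simp] theorem hatL_apply (q : LorentzQuat) : hatL q = qhat q := rfl

/-- The map `cliff` as a continuous linear map. -/
def cliffL : R4 →L[ℝ] LorentzQuat :=
  LinearMap.toContinuousLinearMap
    { toFun := cliff
      map_add' := fun p q => by ext <;> simp
      map_smul' := fun r q => by ext <;> simp }

@[simp] theorem cliffL_apply (x : R4) : cliffL x = cliff x := rfl

/-- The component along `I`. -/
def imIL : LorentzQuat →L[ℝ] LorentzNum :=
  LinearMap.toContinuousLinearMap
    { toFun := fun q => q.imI, map_add' := fun _ _ => rfl, map_smul' := fun _ _ => rfl }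

@[simp] theorem imIL_apply (q : LorentzQuat) : imIL q = q.imI := rfl

/-- The component along `J`. -/
def imJL : LorentzQuat →L[ℝ] LorentzNum :=
  LinearMap.toContinuousLinearMap
    { toFun := fun q => q.imJ, map_add' := fun _ _ => rfl, map_smul' := fun _ _ => rfl }

@[simp] theorem imJL_apply (q : LorentzQuat) : imJL q = q.imJ := rfl

/-- The component along `K`. -/
def imKL : LorentzQuat →L[ℝ] LorentzNum :=
  LinearMap.toContinuousLinearMap
    { toFun := fun q => q.imK, map_add' := fun _ _ => rfl, map_smul' := fun _ _ => rfl }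

@[simp] theorem imKL_apply (q : LorentzQuat) : imKL q = q.imK := rfl

/-- The imaginary quaternion over the Lorentz numbers with the components of a bivector. -/
def ofBivec (η : Bivec) : LorentzQuat :=
  ⟨0, ⟨η 2 3, η 0 1⟩, ⟨η 3 1, η 0 2⟩, ⟨η 1 2, η 0 3⟩⟩

@[simp] theorem re_ofBivec (η : Bivec) : (ofBivec η).re = 0 := rfl
@[simp] theorem imI_ofBivec (η : Bivec) : (ofBivec η).imI = ⟨η 2 3, η 0 1⟩ := rfl
@[simp] theorem imJ_ofBivec (η : Bivec) : (ofBivec η).imJ = ⟨η 3 1, η 0 2⟩ := rfl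
@[simp] theorem imK_ofBivec (η : Bivec) : (ofBivec η).imK = ⟨η 1 2, η 0 3⟩ := rfl

/-- The identification of bivectors of `ℝ⁴` with imaginary quaternions over the Lorentz numbers:
`u ∧ v` goes to the imaginary part of `cliff u * qhat (cliff v)`. -/
def bivecL : Bivec →L[ℝ] LorentzQuat :=
  LinearMap.toContinuousLinearMap
    { toFun := ofBivec
      map_add' := fun p q => by ext <;> simp
      map_smul' := fun r q => by ext <;> simp }

@[simp] theorem bivecL_apply (η : Bivec) : bivecL η = ofBivec η := rfl

/-- The real and `σ` parts of each coefficient of `ofBivec` are components of complementary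
coordinate planes, which the star exchanges. -/
theorem bivecL_hodge (η : Bivec) : bivecL (hodge η) = lsig • bivecL η := by
  ext <;> simp [hodge, lsig]

theorem hodge_antisymm {η : Bivec} (h : ∀ i j, η i j = -η j i) (i j : Fin 4) :
    hodge η i j = -hodge η j i := by
  fin_cases i <;> fin_cases j <;> simp [hodge, h 3 2, h 3 1, h 2 1, h 3 0, h 2 0, h 1 0]

/-- Antisymmetry is needed because `ofBivec` reads only six of the sixteen entries of the array. -/
theorem bivecL_injective {η ζ : Bivec} (hη : ∀ i j, η i j = -η j i) (hζ : ∀ i j, ζ i j = -ζ j i)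
    (h : bivecL η = bivecL ζ) : η = ζ := by
  have h₁ : (ofBivec η).imI = (ofBivec ζ).imI := congrArg (fun q => q.imI) h
  have h₂ : (ofBivec η).imJ = (ofBivec ζ).imJ := congrArg (fun q => q.imJ) h
  have h₃ : (ofBivec η).imK = (ofBivec ζ).imK := congrArg (fun q => q.imK) h
  rw [imI_ofBivec, imI_ofBivec] at h₁
  rw [imJ_ofBivec, imJ_ofBivec] at h₂
  rw [imK_ofBivec, imK_ofBivec] at h₃
  rw [QuadraticAlgebra.mk.injEq] at h₁ h₂ h₃
  have e0 : ∀ i, η i i = ζ i i := fun i => by linarith [hη i i, hζ i i]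
  have hs : ∀ i j, η i j = ζ i j → η j i = ζ j i := fun i j h => by rw [hη j i, hζ j i, h]
  funext i j
  fin_cases i <;> fin_cases j
  · exact e0 0
  · exact h₁.2
  · exact h₂.2
  · exact h₃.2
  · exact hs _ _ h₁.2
  · exact e0 1
  · exact h₃.1
  · exact hs _ _ h₂.1
  · exact hs _ _ h₂.2
  · exact hs _ _ h₃.1
  · exact e0 2
  · exact h₁.1
  · exact hs _ _ h₃.2
  · exact h₂.1
  · exact hs _ _ h₁.1
  · exact e0 3

theorem re_cliff_mul_qhat_cliff (u v : R4) :
    (cliff u * qhat (cliff v)).re = ⟨-inner ℝ u v, 0⟩ := by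
  have h : inner ℝ u v = u 0 * v 0 + u 1 * v 1 + u 2 * v 2 + u 3 * v 3 := by
    simp [PiLp.inner_apply, Fin.sum_univ_four]; ring
  rw [h]
  ext <;> simp [lconj] <;> ring

theorem cliff_mul_qhat_cliff {u v : R4} (huv : inner ℝ u v = 0) :
    cliff u * qhat (cliff v) = ofBivec (wedge u v) := by
  apply QuaternionAlgebra.ext
  · rw [re_cliff_mul_qhat_cliff, huv]; ext <;> simp
  all_goals ext <;> simp [wedge, lconj] <;> ring

end LorentzQuat

/-! ### Moving frames and the spinor -/

namespace LorentzQuat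

@[simp] theorem re_qI : qI.re = 0 := rfl
@[simp] theorem imI_qI : qI.imI = 1 := rfl
@[simp] theorem imJ_qI : qI.imJ = 0 := rfl
@[simp] theorem imK_qI : qI.imK = 0 := rfl

@[simp] theorem re_qJ : qJ.re = 0 := rfl
@[simp] theorem imI_qJ : qJ.imI = 0 := rfl
@[simp] theorem imJ_qJ : qJ.imJ = 1 := rfl
@[simp] theorem imK_qJ : qJ.imK = 0 := rfl

@[simp] theorem re_qK : qK.re = 0 := rfl
@[simp] theorem imI_qK : qK.imI = 0 := rfl
@[simp] theorem imJ_qK : qK.imJ = 0 := rfl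
@[simp] theorem imK_qK : qK.imK = 1 := rfl

theorem qhat_qhat (q : LorentzQuat) : qhat (qhat q) = q := by
  ext <;> simp [lconj]

theorem cliff_single_zero : cliff (EuclideanSpace.single 0 1) = lsig • 1 := by
  ext1 <;> ext <;> simp [lsig]

theorem cliff_single_one : cliff (EuclideanSpace.single 1 1) = qI := by
  ext1 <;> ext <;> simp

theorem cliff_single_two : cliff (EuclideanSpace.single 2 1) = qJ := by
  ext1 <;> ext <;> simp

theorem cliff_single_three : cliff (EuclideanSpace.single 3 1) = qK := by
  ext1 <;> ext <;> simp

theorem qhat_qI : qhat qI = qI := by ext1 <;> ext <;> simp [lconj]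

theorem qhat_qK : qhat qK = qK := by ext1 <;> ext <;> simp [lconj]

theorem inverse_of_formH {q : LorentzQuat} (h : formH q q = 1) :
    Ring.inverse q = star q :=
  Ring.inverse_unit ⟨q, star q, mul_star_of_formH h, star_mul_of_formH h⟩

theorem formH_qhat {q : LorentzQuat} (h : formH q q = 1) : formH (qhat q) (qhat q) = 1 := by
  have := congrArg lconj h
  simp only [formH, lconj_add, lconj_mul] at this ⊢
  simp only [re_qhat, imI_qhat, imJ_qhat, imK_qhat, this]
  ext <;> simp [lconj]

/-- The inner factors `ĝ` cancel and the outer ones meet by cyclic invariance of the real part. A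
scalar product `⟨de_i, e_j⟩` thus depends on `D = dg` only through `D g⁻¹`. -/
theorem re_frame_deriv {g : LorentzQuat} (hg : formH g g = 1) (D A B : LorentzQuat) :
    ((star D * A * qhat g + star g * A * qhat D) * (star (qhat g) * B * g)).re =
      (star (D * star g) * A * B + A * qhat (D * star g) * B).re := by
  have h1 := mul_star_of_formH hg
  have h2 := mul_star_of_formH (formH_qhat hg)
  have e1 : (star D * A * qhat g) * (star (qhat g) * B * g) = (star D * A * B) * g := by
    calc _ = star D * A * (qhat g * star (qhat g)) * B * g := by noncomm_ring
      _ = _ := by rw [h2]; noncomm_ring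
  have e2 : (star g * A * qhat D) * (star (qhat g) * B * g) =
      star g * (A * (qhat D * star (qhat g)) * B * g) := by noncomm_ring
  rw [add_mul, e1, e2, Quaternion.re_add, re_mul_comm _ g, re_mul_comm (star g), Quaternion.re_add,
    mul_assoc _ g (star g), h1, mul_one, qhat_mul, qhat_star, star_mul, star_star]
  simp only [mul_assoc]

/-- The derivative of a product of quaternions. -/
def mulDeriv {E : Type*} [NormedAddCommGroup E] [NormedSpace ℝ E] (p q : LorentzQuat)
    (p' q' : E →L[ℝ] LorentzQuat) : E →L[ℝ] LorentzQuat :=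
  mulL.precompR E p q' + mulL.precompL E p' q

@[simp] theorem mulDeriv_apply {E : Type*} [NormedAddCommGroup E] [NormedSpace ℝ E]
    (p q : LorentzQuat) (p' q' : E →L[ℝ] LorentzQuat) (u : E) :
    mulDeriv p q p' q' u = p * q' u + p' u * q := rfl

theorem hasFDerivAt_mul {E : Type*} [NormedAddCommGroup E] [NormedSpace ℝ E]
    {p q : E → LorentzQuat} {p' q' : E →L[ℝ] LorentzQuat} {x : E}
    (hp : HasFDerivAt p p' x) (hq : HasFDerivAt q q' x) :
    HasFDerivAt (fun y => p y * q y) (mulDeriv (p x) (q x) p' q') x :=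
  mulL.hasFDerivAt_of_bilinear hp hq

theorem hasFDerivAt_star {E : Type*} [NormedAddCommGroup E] [NormedSpace ℝ E]
    {p : E → LorentzQuat} {p' : E →L[ℝ] LorentzQuat} {x : E} (hp : HasFDerivAt p p' x) :
    HasFDerivAt (fun y => star (p y)) (starL ∘L p') x :=
  starL.hasFDerivAt.comp x hp

theorem hasFDerivAt_qhat {E : Type*} [NormedAddCommGroup E] [NormedSpace ℝ E]
    {p : E → LorentzQuat} {p' : E →L[ℝ] LorentzQuat} {x : E} (hp : HasFDerivAt p p' x) :
    HasFDerivAt (fun y => qhat (p y)) (hatL ∘L p') x :=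
  hatL.hasFDerivAt.comp x hp

/-! ### Differentiating the moving frame and the Gauss map -/

section Frames

variable {E : Type*} [NormedAddCommGroup E] [NormedSpace ℝ E]

theorem re_logDeriv {g : E → LorentzQuat} {g' : E →L[ℝ] LorentzQuat} {x : E}
    (hg : HasFDerivAt g g' x) (h1 : ∀ y, formH (g y) (g y) = 1) (u : E) :
    (g' u * star (g x)).re = 0 := by
  have h := hasFDerivAt_mul hg (hasFDerivAt_star hg)
  have hc : (fun y => g y * star (g y)) = fun _ => 1 := funext fun y => mul_star_of_formH (h1 y)
  rw [hc] at h
  have := congrArg (fun L => (L u).re) (h.unique (hasFDerivAt_const 1 x))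
  simp only [mulDeriv_apply, ContinuousLinearMap.comp_apply, starL_apply,
    Quaternion.re_add, zero_apply, Quaternion.re_zero] at this
  have h2 : (g x * star (g' u)).re = (g' u * star (g x)).re := by simp; ring
  rw [h2, ← two_mul] at this
  have h3 := congrArg QuadraticAlgebra.re this
  have h4 := congrArg QuadraticAlgebra.im this
  rw [two_mul] at h3 h4
  simp only [QuadraticAlgebra.re_add, QuadraticAlgebra.im_add, QuadraticAlgebra.re_zero,
    QuadraticAlgebra.im_zero] at h3 h4
  exact QuadraticAlgebra.ext (by rw [QuadraticAlgebra.re_zero]; linarith)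
    (by rw [QuadraticAlgebra.im_zero]; linarith)

theorem cliff_frame_deriv {g : E → LorentzQuat} {g' : E →L[ℝ] LorentzQuat} {x : E}
    (hg : HasFDerivAt g g' x) {v : E → R4} {v' : E →L[ℝ] R4} (hv : HasFDerivAt v v' x)
    {A : LorentzQuat} (h : ∀ y, cliff (v y) = star (g y) * A * qhat (g y)) (u : E) :
    cliff (v' u) = star (g' u) * A * qhat (g x) + star (g x) * A * qhat (g' u) := by
  have h1 := hasFDerivAt_mul (hasFDerivAt_mul (hasFDerivAt_star hg) (hasFDerivAt_const A x))
    (hasFDerivAt_qhat hg)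
  have h2 := cliffL.hasFDerivAt.comp x hv
  have hc : cliffL ∘ v = fun y => star (g y) * A * qhat (g y) := funext h
  rw [hc] at h2
  have := congrArg (fun L => L u) (h2.unique h1)
  simp only [mulDeriv_apply, ContinuousLinearMap.comp_apply, starL_apply,
    hatL_apply, cliffL_apply, zero_apply, mul_zero, zero_add] at this
  rw [this, add_comm]

/-- The vanishing of the connection form in the direction of a pair of frame vectors. -/
theorem re_frame_eq_zero {g : E → LorentzQuat} {g' : E →L[ℝ] LorentzQuat} {x : E}
    (hg : HasFDerivAt g g' x) (h1 : ∀ y, formH (g y) (g y) = 1)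
    {v : E → R4} {v' : E →L[ℝ] R4} (hv : HasFDerivAt v v' x) {w : R4}
    {A B : LorentzQuat} (h : ∀ y, cliff (v y) = star (g y) * A * qhat (g y))
    (hw : cliff w = star (g x) * B * qhat (g x)) {u : E} (h0 : inner ℝ (v' u) w = 0) :
    (star (g' u * star (g x)) * A * qhat B + A * qhat (g' u * star (g x)) * qhat B).re = 0 := by
  have := re_cliff_mul_qhat_cliff (v' u) w
  rw [h0, cliff_frame_deriv hg hv h, hw, qhat_mul, qhat_mul, qhat_star, qhat_qhat,
    re_frame_deriv (h1 x)] at this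
  rw [this]
  ext <;> simp

/-- For `E₀ = σ`, `E₁ = I` the connection form is twice the `σ` part of the `I` component of `Θ`;
for `E₂ = J`, `E₃ = K` it is twice the real part. The difference comes from the conjugation in
`qhat`. -/
theorem imI_logDeriv {g : E → LorentzQuat} {g' : E →L[ℝ] LorentzQuat} {x : E}
    (hg : HasFDerivAt g g' x) (h1 : ∀ y, formH (g y) (g y) = 1)
    {e : Fin 4 → E → R4} {e' : Fin 4 → E →L[ℝ] R4} (he : ∀ i, HasFDerivAt (e i) (e' i) x)
    (h : ∀ i y, cliff (e i y) = star (g y) * cliff (EuclideanSpace.single i 1) * qhat (g y))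
    {u : E} (h01 : inner ℝ (e' 0 u) (e 1 x) = 0) (h23 : inner ℝ (e' 2 u) (e 3 x) = 0) :
    (g' u * star (g x)).imI = 0 := by
  have a := re_frame_eq_zero hg h1 (he 0) (h 0) (h 1 x) h01
  have b := re_frame_eq_zero hg h1 (he 2) (h 2) (h 3 x) h23
  rw [cliff_single_zero, cliff_single_one, qhat_qI] at a
  rw [cliff_single_two, cliff_single_three, qhat_qK] at b
  generalize g' u * star (g x) = Θ at a b
  have a' := congrArg QuadraticAlgebra.re a
  have b' := congrArg QuadraticAlgebra.re b
  simp [lconj, lsig] at a'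
  simp [lconj] at b'
  ext
  · rw [QuadraticAlgebra.re_zero]; linarith
  · rw [QuadraticAlgebra.im_zero]; linarith

theorem bivecL_gauss {g : LorentzQuat} (h1 : formH g g = 1) {v w : R4} (hvw : inner ℝ v w = 0)
    (hv : cliff v = star g * qJ * qhat g) (hw : cliff w = star g * qK * qhat g) :
    bivecL (wedge v w) = star g * qI * g := by
  rw [bivecL_apply, ← cliff_mul_qhat_cliff hvw, hv, hw, qhat_mul, qhat_mul, qhat_star, qhat_qhat,
    qhat_qK]
  have hJK : qJ * qK = qI := by ext1 <;> simp
  calc _ = star g * qJ * (qhat g * star (qhat g)) * qK * g := by noncomm_ring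
    _ = star g * (qJ * qK) * g := by
      rw [mul_star_of_formH (formH_qhat h1)]; noncomm_ring
    _ = _ := by rw [hJK]

/-- When `Θ = dg g⁻¹` lies in the span of `J` and `K`, it satisfies `Θ* = -Θ` and anticommutes with
`I`. The two terms of the Leibniz rule for `g⁻¹ I g` are then equal, which explains the factor `2`.
-/
theorem bivecL_gauss_deriv {g : E → LorentzQuat} {g' : E →L[ℝ] LorentzQuat} {x : E}
    (hg : HasFDerivAt g g' x) (h1 : ∀ y, formH (g y) (g y) = 1)
    {G : E → Bivec} {G' : E →L[ℝ] Bivec} (hG : HasFDerivAt G G' x)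
    (h : ∀ y, bivecL (G y) = star (g y) * qI * g y) {u : E}
    (h0 : (g' u * star (g x)).re = 0) (hI : (g' u * star (g x)).imI = 0) :
    bivecL (G' u) = (2 : LorentzNum) • (star (g x) * qI * g' u) := by
  have a := hasFDerivAt_mul (hasFDerivAt_mul (hasFDerivAt_star hg) (hasFDerivAt_const qI x)) hg
  have b := bivecL.hasFDerivAt.comp x hG
  have hc : bivecL ∘ G = fun y => star (g y) * qI * g y := funext h
  rw [hc] at b
  have := congrArg (fun L => L u) (b.unique a)
  simp only [mulDeriv_apply, ContinuousLinearMap.comp_apply, starL_apply,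
    zero_apply, mul_zero, zero_add] at this
  rw [this, two_smul]
  congr 1
  have hΘ : g' u = (g' u * star (g x)) * g x := by
    rw [mul_assoc, star_mul_of_formH (h1 x), mul_one]
  generalize g' u * star (g x) = Θ at *
  have hs : star Θ * qI = qI * Θ := by
    ext1 <;> simp [h0, hI]
  rw [hΘ, star_mul]
  calc _ = star (g x) * (star Θ * qI) * g x := by noncomm_ring
    _ = _ := by rw [hs]; noncomm_ring

end Frames

end LorentzQuat

/-! ### The spinor representing the constant field along the surface -/

section Spinor

open LorentzQuat

/-- The product of a spin frame and of the coordinate of a spinor in this frame. -/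
def Spinor.eval : Spinor → LorentzQuat :=
  Quot.lift (fun u => u.1.1 * u.2) fun u v ⟨a, h₁, h₂⟩ => by
    rw [h₁, h₂, mul_assoc]

theorem Spinor.eval_mk (s : Spin4) (ξ : LorentzQuat) : (Spinor.mk s ξ).eval = s.1 * ξ := rfl

/-- The product `s ξ` is invariant under the equivalence defining spinors and equals `1` for the
constant field, so `ξ` is the inverse of `s`. -/
theorem Spinor.eq_star_of_mk_eq {s : Spin4} {ξ : LorentzQuat}
    (h : Spinor.mk s ξ = constSpinor) : s.1 = star ξ ∧ ξ = star s.1 ∧ formH ξ ξ = 1 := by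
  have h1 := congrArg Spinor.eval h
  rw [constSpinor, Spinor.eval_mk, Spinor.eval_mk] at h1
  have h2 : s.1 * ξ = 1 := by rw [h1]; exact mul_one _
  have h3 : ξ = star s.1 := by
    calc ξ = star s.1 * s.1 * ξ := by rw [star_mul_of_formH s.2, one_mul]
      _ = star s.1 := by rw [mul_assoc, h2, mul_one]
  refine ⟨by rw [h3, star_star], h3, ?_⟩
  rw [h3, formH_star, s.2]

variable {M : Type*} [TopologicalSpace M] [ChartedSpace R2 M]

/-- The differential at `p` of a map from a surface to a normed space. -/
def surfDeriv {V : Type*} [NormedAddCommGroup V] [NormedSpace ℝ V] (f : M → V) (p : M) :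
    R2 →L[ℝ] V :=
  mfderiv 𝓘(ℝ, R2) 𝓘(ℝ, V) f p

/-- The manifold derivative at `p` is by definition the derivative read in the preferred chart at
`p`; this turns identities between differentials at `p` into ordinary calculus on `R2`. -/
theorem hasFDerivAt_comp_chartAt {V : Type*} [NormedAddCommGroup V] [NormedSpace ℝ V]
    {f : M → V} (hf : ContMDiff 𝓘(ℝ, R2) 𝓘(ℝ, V) ∞ f) (p : M) :
    HasFDerivAt (f ∘ (chartAt R2 p).symm) (surfDeriv f p) (chartAt R2 p p) := by
  have h := ((hf p).mdifferentiableAt (by simp)).hasMFDerivAt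
  have h2 := h.2
  rw [modelWithCornersSelf_coe, Set.range_id] at h2
  have h3 : HasFDerivWithinAt (f ∘ (chartAt R2 p).symm) (surfDeriv f p) Set.univ
    (chartAt R2 p p) := h2
  exact hasFDerivWithinAt_univ.1 h3

theorem isAbove_cliff {s : Spin4} {v : Fin 4 → R4} (h : s.IsAbove v) {ξ : LorentzQuat}
    (hs : s.1 = star ξ) (hξ : formH ξ ξ = 1) (i : Fin 4) :
    cliff (v i) = star ξ * cliff (EuclideanSpace.single i 1) * qhat ξ := by
  have h1 := formH_qhat hξ
  rw [h i, hs, qhat_star, inverse_of_formH (by rw [formH_star, h1]), star_star]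

/-- What the hypotheses on the immersion say about the spinor field `g`: it is a smooth map to the
unit sphere whose logarithmic derivative has values in the span of `J` and `K`, and it determines
the differential of the Gauss map. -/
structure IsGaussSpinor (g : M → LorentzQuat) (G : M → Bivec) : Prop where
  smooth : ContMDiff 𝓘(ℝ, R2) 𝓘(ℝ, LorentzQuat) ∞ g
  formH_eq_one : ∀ p, formH (g p) (g p) = 1
  re_eq_zero : ∀ p (u : R2),
    (surfDeriv g p u * star (g p)).re = 0
  imI_eq_zero : ∀ p (u : R2),
    (surfDeriv g p u * star (g p)).imI = 0
  antisymm : ∀ p (u : R2) (i j : Fin 4),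
    surfDeriv G p u i j =
      -surfDeriv G p u j i
  bivecL_deriv : ∀ p (u : R2),
    bivecL (surfDeriv G p u) =
      (2 : LorentzNum) • (star (g p) * qI *
        surfDeriv g p u)

/-- All that the geometry of the immersion contributes is collected here; the rest of the argument
sees only `g` and `G`. -/
theorem isGaussSpinor_of_frame (o : SurfaceOrientation M) (F : M → R4)
    (e : Fin 4 → M → R4) (he : IsParallelFrame o F e) (G : M → Bivec) (hG : IsGaussMap o F G)
    (g : M → LorentzQuat) (hg : RepresentsConstSpinor e g) : IsGaussSpinor g G := by
  obtain ⟨s, hs, hab, hmk⟩ := hg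
  have h1 : ∀ p, formH (g p) (g p) = 1 := fun p => (Spinor.eq_star_of_mk_eq (hmk p)).2.2
  have hgs : ContMDiff 𝓘(ℝ, R2) 𝓘(ℝ, LorentzQuat) ∞ g := by
    have : g = starL ∘ fun p => (s p).1 := funext fun p => (Spinor.eq_star_of_mk_eq (hmk p)).2.1
    rw [this]
    exact starL.contMDiff.comp hs
  have hcl : ∀ i p, cliff (e i p) =
      star (g p) * cliff (EuclideanSpace.single i 1) * qhat (g p) := fun i p =>
    isAbove_cliff (hab p) (Spinor.eq_star_of_mk_eq (hmk p)).1 (h1 p) i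
  have hGe : G = fun p => wedge (e 2 p) (e 3 p) := by
    funext p
    obtain ⟨u, v, hu, hv, huv⟩ := he.tangent p
    rw [hG p u v huv, hu, hv]
    rw [hu, hv]
    have := (he.orthonormal p).comp ![2, 3] (by intro i j; fin_cases i <;> fin_cases j <;> simp)
    convert this using 1
    ext1 i
    fin_cases i <;> rfl
  have hGs : ContMDiff 𝓘(ℝ, R2) 𝓘(ℝ, Bivec) ∞ G := by
    have hc : ∀ k i, ContMDiff 𝓘(ℝ, R2) 𝓘(ℝ, ℝ) ∞ (fun p => e k p i) := fun k i =>
      ((EuclideanSpace.proj i : R4 →L[ℝ] ℝ).contMDiff.comp (he.smooth k))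
    rw [hGe, contMDiff_pi_space]
    intro i
    rw [contMDiff_pi_space]
    intro j
    exact ((hc 2 i).mul (hc 3 j)).sub ((hc 2 j).mul (hc 3 i))
  have hbG : ∀ p, bivecL (G p) = star (g p) * qI * g p := by
    intro p
    rw [hGe]
    refine bivecL_gauss (h1 p) ((he.orthonormal p).2 (by decide)) ?_ ?_
    · rw [hcl, cliff_single_two]
    · rw [hcl, cliff_single_three]
  have hgd := hasFDerivAt_comp_chartAt hgs
  have hx : ∀ p : M, (chartAt R2 p).symm (chartAt R2 p p) = p := fun p =>
    (chartAt R2 p).left_inv (mem_chart_source R2 p)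
  have hre : ∀ p (u : R2),
    (surfDeriv g p u * star (g p)).re = 0 := by
    intro p u
    have := re_logDeriv (hgd p) (fun y => h1 _) u
    rwa [Function.comp_apply, hx] at this
  have hI : ∀ p (u : R2),
    (surfDeriv g p u * star (g p)).imI = 0 := by
    intro p u
    -- The two parallelism conditions are tested on `e₁`, which is normal, and on `e₃ = dF v`, which
    -- is tangent: these pairings are the connection forms of the two bundles.
    obtain ⟨t, v, ht, hv, -⟩ := he.tangent p
    have h01 := (he.parallel_normal p u (e 1 p) (he.normal p).2).1
    have h23 := (he.parallel_tangent p u v).1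
    rw [hv] at h23
    have := imI_logDeriv (hgd p) (fun y => h1 _)
      (e := fun i => e i ∘ (chartAt R2 p).symm)
      (fun i => hasFDerivAt_comp_chartAt (he.smooth i) p) (fun i y => hcl i _) (u := u)
      (by rw [Function.comp_apply, hx]; exact h01) (by rw [Function.comp_apply, hx]; exact h23)
    rwa [Function.comp_apply, hx] at this
  refine ⟨hgs, h1, hre, hI, ?_, ?_⟩
  · intro p u i j
    have hd := hasFDerivAt_comp_chartAt hGs p
    have hij : ∀ i j, HasFDerivAt (fun y => (G ∘ (chartAt R2 p).symm) y i j) _ (chartAt R2 p p) :=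
      fun i j => hasFDerivAt_pi'.1 (hasFDerivAt_pi'.1 hd i) j
    have h2 := (hij j i).neg
    have hc : -(fun y => (G ∘ (chartAt R2 p).symm) y j i) =
        fun y => (G ∘ (chartAt R2 p).symm) y i j := by
      funext y
      simp [hGe, wedge]
    rw [hc] at h2
    exact congrArg (fun L => L u) ((hij i j).unique h2)
  · intro p u
    have := bivecL_gauss_deriv (hgd p) (fun y => h1 _) (hasFDerivAt_comp_chartAt hGs p)
      (fun y => hbG _) (u := u) (by rw [Function.comp_apply, hx]; exact hre p u)
      (by rw [Function.comp_apply, hx]; exact hI p u)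
    rwa [Function.comp_apply, hx] at this

variable {g : M → LorentzQuat} {G : M → Bivec}

theorem two_smul_star_mul_qI_injective {q : LorentzQuat} (hq : formH q q = 1) :
    Function.Injective fun x : LorentzQuat => (2 : LorentzNum) • (star q * qI * x) := by
  have hq' := mul_star_of_formH hq
  have key : ∀ x : LorentzQuat, -(qI * q * (star q * qI * x)) = x := by
    intro x
    calc _ = -(qI * (q * star q) * qI * x) := by noncomm_ring
      _ = -(qI * qI * x) := by rw [hq', mul_one]
      _ = x := by ext1 <;> simp
  intro x y hxy
  simp only [two_smul] at hxy
  -- The Lorentz numbers have zero divisors, so the factor `2` is cancelled as a real scalar.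
  rw [← two_smul ℝ, ← two_smul ℝ] at hxy
  rw [← key x, ← key y, smul_right_injective _ (two_ne_zero : (2 : ℝ) ≠ 0) hxy]

/-- Both sides correspond under `dG = 2 g⁻¹ I dg`: left multiplication by `2 g⁻¹ I` is injective and
commutes with `σ`. -/
theorem IsGaussSpinor.hodge_iff (h : IsGaussSpinor g G) (p : M) (u v : R2) :
    surfDeriv G p v =
        hodge (surfDeriv G p u) ↔
      surfDeriv g p v =
        lsig • surfDeriv g p u := by
  rw [← (two_smul_star_mul_qI_injective (h.formH_eq_one p)).eq_iff]
  beta_reduce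
  rw [mul_smul', smul_comm, ← h.bivecL_deriv, ← h.bivecL_deriv, ← bivecL_hodge]
  exact ⟨congrArg _, bivecL_injective (h.antisymm p v) (hodge_antisymm (h.antisymm p u))⟩

theorem IsGaussSpinor.injective (h : IsGaussSpinor g G) {p : M}
    (hG : Function.Injective (mfderiv 𝓘(ℝ, R2) 𝓘(ℝ, Bivec) G p)) :
    Function.Injective (mfderiv 𝓘(ℝ, R2) 𝓘(ℝ, LorentzQuat) g p) := by
  intro u v huv
  apply hG
  apply bivecL_injective (h.antisymm p u) (h.antisymm p v)
  have e := h.bivecL_deriv p u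
  rw [show surfDeriv g p u =
    surfDeriv g p v from huv,
    ← h.bivecL_deriv p v] at e
  exact e

end Spinor

/-! ### Closed forms -/

section ClosedForms

variable {E : Type*} [NormedAddCommGroup E] [NormedSpace ℝ E]

theorem HasFDerivAt.clm_eval {V W : Type*} [NormedAddCommGroup V] [NormedSpace ℝ V]
    [NormedAddCommGroup W] [NormedSpace ℝ W] {b : E → V →L[ℝ] W} {b' : E →L[ℝ] V →L[ℝ] W} {x : E}
    (hb : HasFDerivAt b b' x) (k : V) :
    HasFDerivAt (fun y => b y k) ((ContinuousLinearMap.apply ℝ W k) ∘L b') x :=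
  (ContinuousLinearMap.apply ℝ W k).hasFDerivAt.comp x hb

/-- Two closed and proportional `1`-forms, not both zero at a point, are locally of the form
`β dw` and `γ dw` with `β ^ 2 + γ ^ 2 = 1`. -/
theorem exists_arcLength_potential {U : Set E} (hU : IsOpen U) {b c : E → E →L[ℝ] ℝ}
    (hb : ContDiffOn ℝ ∞ b U) (hc : ContDiffOn ℝ ∞ c U)
    (hbs : ∀ x ∈ U, ∀ h k, fderiv ℝ b x h k = fderiv ℝ b x k h)
    (hcs : ∀ x ∈ U, ∀ h k, fderiv ℝ c x h k = fderiv ℝ c x k h)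
    (hbc : ∀ x ∈ U, ∀ h k, b x h * c x k = b x k * c x h)
    {x₀ : E} (hx₀ : x₀ ∈ U) (hne : ¬ (b x₀ = 0 ∧ c x₀ = 0)) :
    ∃ r > 0, Metric.ball x₀ r ⊆ U ∧ ∃ w : E → ℝ, ContDiffOn ℝ ∞ w (Metric.ball x₀ r) ∧
      ∀ x ∈ Metric.ball x₀ r, ∃ β γ : ℝ, β * β + γ * γ = 1 ∧
        ∀ h, b x h = β * fderiv ℝ w x h ∧ c x h = γ * fderiv ℝ w x h := by
  obtain ⟨u, hu⟩ : ∃ u, b x₀ u ≠ 0 ∨ c x₀ u ≠ 0 := by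
    by_contra! h
    exact hne ⟨ContinuousLinearMap.ext fun u => (h u).1, ContinuousLinearMap.ext fun u => (h u).2⟩
  -- The pair `(b, c)` has a constant direction over all tangent vectors, so it can be read on the
  -- single vector `u`; `(β, γ)` is `(b u, c u)` normalized, on a ball where it does not vanish.
  set N : E → ℝ := fun x => b x u * b x u + c x u * c x u with hN
  have hbu : ContDiffOn ℝ ∞ (fun x => b x u) U := hb.clm_apply contDiffOn_const
  have hcu : ContDiffOn ℝ ∞ (fun x => c x u) U := hc.clm_apply contDiffOn_const
  have hNs : ContDiffOn ℝ ∞ N U := (hbu.mul hbu).add (hcu.mul hcu)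
  have hN0 : 0 < N x₀ := by
    rcases hu with h | h
    · have := mul_self_pos.2 h; have := mul_self_nonneg (c x₀ u); simp only [hN]; linarith
    · have := mul_self_pos.2 h; have := mul_self_nonneg (b x₀ u); simp only [hN]; linarith
  obtain ⟨r, hr, hrU⟩ : ∃ r > 0, Metric.ball x₀ r ⊆ U ∩ {x | 0 < N x} := by
    have : U ∩ {x | 0 < N x} ∈ nhds x₀ := Filter.inter_mem (hU.mem_nhds hx₀)
      ((hNs.continuousOn.continuousAt (hU.mem_nhds hx₀)).eventually_const_lt hN0)
    exact Metric.mem_nhds_iff.1 this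
  set B := Metric.ball x₀ r
  have hBo : IsOpen B := Metric.isOpen_ball
  have hBU : B ⊆ U := fun x hx => (hrU hx).1
  have hBN : ∀ x ∈ B, 0 < N x := fun x hx => (hrU hx).2
  have hS : ContDiffOn ℝ ∞ (fun x => (√(N x))⁻¹) B :=
    ((hNs.mono hBU).sqrt fun x hx => (hBN x hx).ne').inv
      fun x hx => (Real.sqrt_pos.2 (hBN x hx)).ne'
  set β : E → ℝ := fun x => b x u * (√(N x))⁻¹ with hβ
  set γ : E → ℝ := fun x => c x u * (√(N x))⁻¹ with hγ
  have hβs : ContDiffOn ℝ ∞ β B := (hbu.mono hBU).mul hS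
  have hγs : ContDiffOn ℝ ∞ γ B := (hcu.mono hBU).mul hS
  have h1 : ∀ x ∈ B, β x * β x + γ x * γ x = 1 := by
    intro x hx
    have h2 := Real.mul_self_sqrt (hBN x hx).le
    have h3 := (Real.sqrt_pos.2 (hBN x hx)).ne'
    simp only [hβ, hγ]
    field_simp
    rw [pow_two (√(N x)), h2, hN]
    ring
  set τ : E → E →L[ℝ] ℝ := fun x => β x • b x + γ x • c x with hτ
  have hτs : ContDiffOn ℝ ∞ τ B := (hβs.smul (hb.mono hBU)).add (hγs.smul (hc.mono hBU))
  have hrel : ∀ x ∈ B, ∀ h, β x * c x h = γ x * b x h := by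
    intro x hx h
    simp only [hβ, hγ]
    have := hbc x (hBU hx) u h
    linear_combination (√(N x))⁻¹ * this
  have hbτ : ∀ x ∈ B, ∀ h, b x h = β x * τ x h := by
    intro x hx h
    have := hrel x hx h
    simp only [hτ, add_apply, smul_apply, smul_eq_mul]
    linear_combination -(b x h) * h1 x hx - γ x * this
  have hcτ : ∀ x ∈ B, ∀ h, c x h = γ x * τ x h := by
    intro x hx h
    have := hrel x hx h
    simp only [hτ, add_apply, smul_apply, smul_eq_mul]
    linear_combination -(c x h) * h1 x hx + β x * this
  have htop : (∞ : WithTop ℕ∞) ≠ 0 := by simp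
  -- As `b = β τ` and `c = γ τ` are closed, `dτ = dβ ∧ b + dγ ∧ c = (β dβ + γ dγ) ∧ τ`, and the
  -- bracket is half the differential of `β² + γ² = 1`. The potential then comes from the Poincaré
  -- lemma on the ball.
  have hsymm : ∀ x ∈ B, ∀ h k, fderiv ℝ τ x h k = fderiv ℝ τ x k h := by
    intro x hx
    have hβd := ((hβs.contDiffAt (hBo.mem_nhds hx)).differentiableAt htop).hasFDerivAt
    have hγd := ((hγs.contDiffAt (hBo.mem_nhds hx)).differentiableAt htop).hasFDerivAt
    have hbd := ((hb.contDiffAt (hU.mem_nhds (hBU hx))).differentiableAt htop).hasFDerivAt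
    have hcd := ((hc.contDiffAt (hU.mem_nhds (hBU hx))).differentiableAt htop).hasFDerivAt
    have hτd := ((hτs.contDiffAt (hBo.mem_nhds hx)).differentiableAt htop).hasFDerivAt
    have hD : ∀ h k, fderiv ℝ τ x h k = β x * fderiv ℝ b x h k + fderiv ℝ β x h * b x k +
        (γ x * fderiv ℝ c x h k + fderiv ℝ γ x h * c x k) := by
      intro h k
      have e1 := hτd.clm_eval k
      have e2 := (hβd.mul (hbd.clm_eval k)).add (hγd.mul (hcd.clm_eval k))
      have e3 := congrArg (fun L => L h) (e1.unique e2)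
      simp only [ContinuousLinearMap.comp_apply, ContinuousLinearMap.apply_apply, add_apply,
        smul_apply, smul_eq_mul] at e3
      rw [e3]
      ring
    have hN1 : ∀ h, β x * fderiv ℝ β x h + γ x * fderiv ℝ γ x h = 0 := by
      intro h
      have e1 := (hβd.mul hβd).add (hγd.mul hγd)
      have e2 : (fun y => β y * β y + γ y * γ y) =ᶠ[nhds x] fun _ => (1 : ℝ) := by
        filter_upwards [hBo.mem_nhds hx] with y hy using h1 y hy
      have e3 := congrArg (fun L => L h)
        (HasFDerivAt.unique e1 ((hasFDerivAt_const (1 : ℝ) x).congr_of_eventuallyEq e2))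
      simp only [add_apply, smul_apply, smul_eq_mul, zero_apply] at e3
      linarith
    intro h k
    rw [hD h k, hD k h, hbτ x hx h, hbτ x hx k, hcτ x hx h, hcτ x hx k, hbs x (hBU hx) h k,
      hcs x (hBU hx) h k]
    linear_combination τ x k * hN1 h - τ x h * hN1 k
  obtain ⟨w, hw⟩ := (convex_ball x₀ r).exists_forall_hasFDerivAt_of_fderiv_symmetric hBo
    (hτs.differentiableOn htop) hsymm
  refine ⟨r, hr, hBU, w, ?_, fun x hx => ⟨β x, γ x, h1 x hx, fun h => ?_⟩⟩
  · rw [contDiffOn_infty_iff_fderiv_of_isOpen hBo]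
    exact ⟨fun x hx => (hw x hx).differentiableAt.differentiableWithinAt,
      hτs.congr fun x hx => (hw x hx).fderiv⟩
  · rw [(hw x hx).fderiv]
    exact ⟨hbτ x hx h, hcτ x hx h⟩

end ClosedForms

/-! ### Local arc length coordinates -/

section LocalCoordinates

open LorentzQuat

variable {E : Type*} [NormedAddCommGroup E] [NormedSpace ℝ E]

/-- The right logarithmic derivative `df f⁻¹` of a map to the unit sphere. -/
def rightLogDeriv (f : E → LorentzQuat) (x : E) : E →L[ℝ] LorentzQuat :=
  (mulL.flip (star (f x))) ∘L fderiv ℝ f x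

theorem rightLogDeriv_apply (f : E → LorentzQuat) (x h : E) :
    rightLogDeriv f x h = fderiv ℝ f x h * star (f x) := rfl

theorem contDiffOn_rightLogDeriv {f : E → LorentzQuat} {U : Set E} (hU : IsOpen U)
    (hf : ContDiffOn ℝ ∞ f U) : ContDiffOn ℝ ∞ (rightLogDeriv f) U := by
  have h1 : ContDiffOn ℝ ∞ (fderiv ℝ f) U := hf.fderiv_of_isOpen hU (by simp)
  have h2 : ContDiffOn ℝ ∞ (fun x => mulL.flip (starL (f x))) U :=
    mulL.flip.contDiff.comp_contDiffOn (starL.contDiff.comp_contDiffOn hf)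
  exact h2.clm_comp h1

/-- The Maurer-Cartan equation. -/
theorem fderiv_rightLogDeriv_sub {f : E → LorentzQuat} {U : Set E} (hU : IsOpen U)
    (hf : ContDiffOn ℝ ∞ f U) (h1 : ∀ x ∈ U, formH (f x) (f x) = 1) {x : E} (hx : x ∈ U)
    (ℓ : LorentzQuat →L[ℝ] ℝ) (h k : E) :
    fderiv ℝ (fun y => ℓ ∘L rightLogDeriv f y) x h k -
        fderiv ℝ (fun y => ℓ ∘L rightLogDeriv f y) x k h =
      ℓ (rightLogDeriv f x k * star (rightLogDeriv f x h) -
        rightLogDeriv f x h * star (rightLogDeriv f x k)) := by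
  have htop : (∞ : WithTop ℕ∞) ≠ 0 := by simp
  have hfx := hf.contDiffAt (hU.mem_nhds hx)
  have hfd := (hfx.differentiableAt htop).hasFDerivAt
  have hfdd := (((hf.fderiv_of_isOpen hU (m := ∞) (by simp)).contDiffAt
    (hU.mem_nhds hx)).differentiableAt htop).hasFDerivAt
  have hΘ : ContDiffOn ℝ ∞ (fun y => ℓ ∘L rightLogDeriv f y) U :=
    contDiffOn_const.clm_comp (contDiffOn_rightLogDeriv hU hf)
  have hΘd := ((hΘ.contDiffAt (hU.mem_nhds hx)).differentiableAt htop).hasFDerivAt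
  have key : ∀ h k, fderiv ℝ (fun y => ℓ ∘L rightLogDeriv f y) x h k =
      ℓ (fderiv ℝ f x k * star (fderiv ℝ f x h) + fderiv ℝ (fderiv ℝ f) x h k * star (f x)) := by
    intro h k
    have e1 := hΘd.clm_eval k
    have e2 := ℓ.hasFDerivAt.comp x (hasFDerivAt_mul (hfdd.clm_eval k) (hasFDerivAt_star hfd))
    exact congrArg (fun L => L h) (e1.unique e2)
  have hsymm : fderiv ℝ (fderiv ℝ f) x h k = fderiv ℝ (fderiv ℝ f) x k h :=
    (hfx.isSymmSndFDerivAt (by simpa using WithTop.coe_le_coe.2 (le_top : (2 : ℕ∞) ≤ ⊤))).eq h k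
  -- The second derivatives of `f` cancel by symmetry; the remaining products `df df*` become `Θ Θ*`
  -- because `f* f = 1`.
  have hsub : ∀ h k, rightLogDeriv f x k * star (rightLogDeriv f x h) =
      fderiv ℝ f x k * star (fderiv ℝ f x h) := by
    intro h k
    rw [rightLogDeriv_apply, rightLogDeriv_apply, star_mul, star_star]
    calc _ = fderiv ℝ f x k * (star (f x) * f x) * star (fderiv ℝ f x h) := by noncomm_ring
      _ = _ := by rw [star_mul_of_formH (h1 x hx), mul_one]
  rw [key h k, key k h, hsymm, ← map_sub, hsub, hsub]
  congr 1
  abel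

/-- Two linear forms on the Lorentz numbers without common kernel are independent. -/
theorem det_ne_zero_of_ker {p q : LorentzNum →L[ℝ] ℝ}
    (h : ∀ a, p a = 0 → q a = 0 → a = 0) : p 1 * q lsig - q 1 * p lsig ≠ 0 := by
  intro h0
  -- This vector is killed by `p` always and by `q` when the determinant vanishes. Its vanishing
  -- gives `p 1 = 0`, the next one gives `q 1 = 0`, and then `1` lies in the common kernel.
  have e1 : (p lsig • (1 : LorentzNum) - p 1 • lsig) = 0 := by
    apply h <;> simp only [map_sub, map_smul, smul_eq_mul]
    · ring
    · linear_combination -h0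
  have e2 : (q lsig • (1 : LorentzNum) - q 1 • lsig) = 0 := by
    apply h <;> simp only [map_sub, map_smul, smul_eq_mul]
    · linear_combination h0
    · ring
  have e3 := congrArg QuadraticAlgebra.im e1
  have e4 := congrArg QuadraticAlgebra.im e2
  simp [lsig] at e3 e4
  have := congrArg QuadraticAlgebra.re (h 1 e3 e4)
  simp at this

/-- The determinant of a linear endomorphism of the plane of Lorentz numbers. -/
def ldet (L : LorentzNum →L[ℝ] LorentzNum) : ℝ := (L 1).re * (L lsig).im - (L 1).im * (L lsig).re

/-- A map from an open set of Lorentz numbers to the unit sphere, with injective differential and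
with logarithmic derivative in the span of `J` and `K`. -/
structure IsLegendrianOn (f : LorentzNum → LorentzQuat) (U : Set LorentzNum) : Prop where
  isOpen : IsOpen U
  contDiffOn : ContDiffOn ℝ ∞ f U
  formH_eq_one : ∀ x ∈ U, formH (f x) (f x) = 1
  re_eq_zero : ∀ x ∈ U, ∀ h, (fderiv ℝ f x h * star (f x)).re = 0
  imI_eq_zero : ∀ x ∈ U, ∀ h, (fderiv ℝ f x h * star (f x)).imI = 0
  injective : ∀ x ∈ U, ∀ h, fderiv ℝ f x h = 0 → h = 0

namespace IsLegendrianOn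

variable {f : LorentzNum → LorentzQuat} {U : Set LorentzNum}

theorem rightLogDeriv_eq (hf : IsLegendrianOn f U) {x : LorentzNum} (hx : x ∈ U) (h : LorentzNum) :
    rightLogDeriv f x h = (rightLogDeriv f x h).imJ • qJ + (rightLogDeriv f x h).imK • qK := by
  ext1 <;> simp only [rightLogDeriv_apply]
  · rw [hf.re_eq_zero x hx h]; simp
  · rw [hf.imI_eq_zero x hx h]; simp
  · simp
  · simp

theorem fderiv_eq (hf : IsLegendrianOn f U) {x : LorentzNum} (hx : x ∈ U) (h : LorentzNum) :
    fderiv ℝ f x h =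
      ((rightLogDeriv f x h).imJ • qJ + (rightLogDeriv f x h).imK • qK) * f x := by
  rw [← hf.rightLogDeriv_eq hx, rightLogDeriv_apply, mul_assoc,
    star_mul_of_formH (hf.formH_eq_one x hx), mul_one]

theorem eq_zero_of_forms (hf : IsLegendrianOn f U) {x : LorentzNum} (hx : x ∈ U) {h : LorentzNum}
    (h1 : (rightLogDeriv f x h).imJ = 0) (h2 : (rightLogDeriv f x h).imK = 0) : h = 0 := by
  apply hf.injective x hx
  rw [hf.fderiv_eq hx, h1, h2]
  ext1 <;> simp

variable (ρ : LorentzNum →L[ℝ] ℝ)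

/-- Products of two elements of the span of `J` and `K` lie in the span of `1` and `I`, so the
quadratic term of the Maurer–Cartan equation has no `J` component; likewise for `K` below. -/
theorem closed_imJ (hf : IsLegendrianOn f U) {x : LorentzNum} (hx : x ∈ U) (h k : LorentzNum) :
    fderiv ℝ (fun y => (ρ ∘L imJL) ∘L rightLogDeriv f y) x h k =
      fderiv ℝ (fun y => (ρ ∘L imJL) ∘L rightLogDeriv f y) x k h := by
  rw [← sub_eq_zero, fderiv_rightLogDeriv_sub hf.isOpen hf.contDiffOn hf.formH_eq_one hx,
    hf.rightLogDeriv_eq hx h, hf.rightLogDeriv_eq hx k]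
  simp

theorem closed_imK (hf : IsLegendrianOn f U) {x : LorentzNum} (hx : x ∈ U) (h k : LorentzNum) :
    fderiv ℝ (fun y => (ρ ∘L imKL) ∘L rightLogDeriv f y) x h k =
      fderiv ℝ (fun y => (ρ ∘L imKL) ∘L rightLogDeriv f y) x k h := by
  rw [← sub_eq_zero, fderiv_rightLogDeriv_sub hf.isOpen hf.contDiffOn hf.formH_eq_one hx,
    hf.rightLogDeriv_eq hx h, hf.rightLogDeriv_eq hx k]
  simp

/-- The `I` component of `Θ` is identically zero, so the Maurer–Cartan equation along `I` reduces to
its quadratic term `η ∧ ζ`. A multiplicative `ρ` turns it into proportionality of two real forms. -/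
theorem wedge_eq_zero (hf : IsLegendrianOn f U) {x : LorentzNum} (hx : x ∈ U) (h k : LorentzNum)
    (hρ : ∀ a b, ρ (a * b) = ρ a * ρ b) :
    ρ (rightLogDeriv f x h).imJ * ρ (rightLogDeriv f x k).imK =
      ρ (rightLogDeriv f x k).imJ * ρ (rightLogDeriv f x h).imK := by
  have e := fderiv_rightLogDeriv_sub hf.isOpen hf.contDiffOn hf.formH_eq_one hx (ρ ∘L imIL) h k
  have e0 : (fun y => (ρ ∘L imIL) ∘L rightLogDeriv f y) =ᶠ[nhds x] fun _ => 0 := by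
    filter_upwards [hf.isOpen.mem_nhds hx] with y hy
    ext u
    simp [rightLogDeriv_apply, hf.imI_eq_zero y hy u]
  rw [e0.fderiv_eq, hf.rightLogDeriv_eq hx h, hf.rightLogDeriv_eq hx k] at e
  simp [hρ] at e
  linarith

theorem exists_potential (hf : IsLegendrianOn f U) (hρ : ∀ a b, ρ (a * b) = ρ a * ρ b)
    {ρ' : LorentzNum →L[ℝ] ℝ} (hρ' : ∀ a b, ρ' (a * b) = ρ' a * ρ' b)
    (hinj : ∀ a, ρ a = 0 → ρ' a = 0 → a = 0) {x₀ : LorentzNum} (hx₀ : x₀ ∈ U) :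
    ∃ r > 0, Metric.ball x₀ r ⊆ U ∧ ∃ w : LorentzNum → ℝ,
      ContDiffOn ℝ ∞ w (Metric.ball x₀ r) ∧
      ∀ x ∈ Metric.ball x₀ r, ∃ β γ : ℝ, β * β + γ * γ = 1 ∧
        ∀ h, ρ (rightLogDeriv f x h).imJ = β * fderiv ℝ w x h ∧
          ρ (rightLogDeriv f x h).imK = γ * fderiv ℝ w x h := by
  have hΘ := contDiffOn_rightLogDeriv hf.isOpen hf.contDiffOn
  refine exists_arcLength_potential hf.isOpen
    (b := fun y => (ρ ∘L imJL) ∘L rightLogDeriv f y)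
    (c := fun y => (ρ ∘L imKL) ∘L rightLogDeriv f y)
    (contDiffOn_const.clm_comp hΘ) (contDiffOn_const.clm_comp hΘ)
    (fun x hx h k => hf.closed_imJ ρ hx h k) (fun x hx h k => hf.closed_imK ρ hx h k)
    (fun x hx h k => hf.wedge_eq_zero ρ hx h k hρ) hx₀ ?_
  rintro ⟨hb, hc⟩
  -- If both forms for `ρ` vanished at `x₀`, those for the other character `ρ'` would have to
  -- separate vectors, since `df` is injective; but they are proportional as well.
  refine det_ne_zero_of_ker (p := (ρ' ∘L imJL) ∘L rightLogDeriv f x₀)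
    (q := (ρ' ∘L imKL) ∘L rightLogDeriv f x₀) (fun a h1 h2 => ?_) ?_
  · have h3 := congrArg (fun L => L a) hb
    have h4 := congrArg (fun L => L a) hc
    exact hf.eq_zero_of_forms hx₀ (hinj _ h3 h1) (hinj _ h4 h2)
  · have := hf.wedge_eq_zero ρ' hx₀ 1 lsig hρ'
    simp only [ContinuousLinearMap.comp_apply, imJL_apply, imKL_apply]
    linarith

/-- Local coordinates `w` with values in the Lorentz numbers in which `df = f' dw` with
`H(f', f') = 1`. -/
theorem exists_coordinate (hf : IsLegendrianOn f U) {x₀ : LorentzNum} (hx₀ : x₀ ∈ U) :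
    ∃ V ⊆ U, IsOpen V ∧ x₀ ∈ V ∧ ∃ w : LorentzNum → LorentzNum, ContDiffOn ℝ ∞ w V ∧
      ∀ x ∈ V, 0 < ldet (fderiv ℝ w x) ∧ ∃ q : LorentzQuat, formH q q = 1 ∧
        ∀ h, fderiv ℝ f x h = fderiv ℝ w x h • q := by
  obtain ⟨r, hr, hrU, w₁, hw₁, H₁⟩ := hf.exists_potential LorentzNum.plus LorentzNum.plus_mul
    LorentzNum.minus_mul (fun a h h' => LorentzNum.ext_plus_minus (by simpa using h)
      (by simpa using h')) hx₀
  obtain ⟨r', hr', hrU', w₂, hw₂, H₂⟩ := hf.exists_potential LorentzNum.minus LorentzNum.minus_mul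
    LorentzNum.plus_mul (fun a h h' => LorentzNum.ext_plus_minus (by simpa using h')
      (by simpa using h)) hx₀
  set B := Metric.ball x₀ r ∩ Metric.ball x₀ r' with hB
  have hBo : IsOpen B := Metric.isOpen_ball.inter Metric.isOpen_ball
  have hxB : x₀ ∈ B := ⟨Metric.mem_ball_self hr, Metric.mem_ball_self hr'⟩
  have htop : (∞ : WithTop ℕ∞) ≠ 0 := by simp
  have hd₁ : ∀ x ∈ B, HasFDerivAt w₁ (fderiv ℝ w₁ x) x := fun x hx =>
    ((hw₁.contDiffAt (Metric.isOpen_ball.mem_nhds hx.1)).differentiableAt htop).hasFDerivAt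
  have hd₂ : ∀ x ∈ B, HasFDerivAt w₂ (fderiv ℝ w₂ x) x := fun x hx =>
    ((hw₂.contDiffAt (Metric.isOpen_ball.mem_nhds hx.2)).differentiableAt htop).hasFDerivAt
  -- A vector killed by `dw₁` and `dw₂` is killed by both characters of `η` and `ζ`, hence by `df`.
  have hdet : fderiv ℝ w₁ x₀ 1 * fderiv ℝ w₂ x₀ lsig - fderiv ℝ w₂ x₀ 1 * fderiv ℝ w₁ x₀ lsig
      ≠ 0 := by
    apply det_ne_zero_of_ker
    intro a h1 h2
    obtain ⟨β₁, γ₁, -, e₁⟩ := H₁ x₀ hxB.1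
    obtain ⟨β₂, γ₂, -, e₂⟩ := H₂ x₀ hxB.2
    refine hf.eq_zero_of_forms hx₀ (LorentzNum.ext_plus_minus ?_ ?_)
      (LorentzNum.ext_plus_minus ?_ ?_)
    · rw [(e₁ a).1, h1]; simp
    · rw [(e₂ a).1, h2]; simp
    · rw [(e₁ a).2, h1]; simp
    · rw [(e₂ a).2, h2]; simp
  -- The sign of `w₂` is free, since `β₂`, `γ₂` can change sign with it; it is used to make `w`
  -- orientation preserving. The minus sign is there because `plus` and `minus` form a negatively
  -- oriented basis of the dual plane.
  obtain ⟨ε, hε, hpos⟩ : ∃ ε : ℝ, ε * ε = 1 ∧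
      0 < -ε * (fderiv ℝ w₁ x₀ 1 * fderiv ℝ w₂ x₀ lsig -
        fderiv ℝ w₂ x₀ 1 * fderiv ℝ w₁ x₀ lsig) := by
    rcases lt_or_gt_of_ne hdet with h | h
    · exact ⟨1, by norm_num, by linarith⟩
    · exact ⟨-1, by norm_num, by linarith⟩
  set w : LorentzNum → LorentzNum := fun x => LorentzNum.ofPair (w₁ x, ε * w₂ x) with hw
  have hws : ContDiffOn ℝ ∞ w B := LorentzNum.ofPair.contDiff.comp_contDiffOn
    ((hw₁.mono Set.inter_subset_left).prodMk
      (contDiffOn_const.mul (hw₂.mono Set.inter_subset_right)))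
  have hwd : ∀ x ∈ B, ∀ h, fderiv ℝ w x h =
      LorentzNum.ofPair (fderiv ℝ w₁ x h, ε * fderiv ℝ w₂ x h) := by
    intro x hx h
    have e1 : HasFDerivAt w _ x := LorentzNum.ofPair.hasFDerivAt.comp x
      ((hd₁ x hx).prodMk ((hd₂ x hx).const_mul ε))
    rw [e1.fderiv]
    rfl
  have hld : ∀ x ∈ B, ldet (fderiv ℝ w x) = -ε / 2 * (fderiv ℝ w₁ x 1 * fderiv ℝ w₂ x lsig -
        fderiv ℝ w₂ x 1 * fderiv ℝ w₁ x lsig) := by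
    intro x hx
    rw [ldet, hwd x hx, hwd x hx, LorentzNum.ofPair_apply, LorentzNum.ofPair_apply]
    ring
  have hcont : ContinuousOn (fun x => ldet (fderiv ℝ w x)) B := by
    have h1 : ContinuousOn (fderiv ℝ w) B :=
      hws.continuousOn_fderiv_of_isOpen hBo (by simp)
    have h2 : ∀ a (ℓ : LorentzNum →L[ℝ] ℝ), ContinuousOn (fun x => ℓ (fderiv ℝ w x a)) B :=
      fun a ℓ => ℓ.continuous.comp_continuousOn (h1.clm_apply continuousOn_const)
    have h3 : (fun x => ldet (fderiv ℝ w x)) = fun x =>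
        (LorentzNum.minus (fderiv ℝ w x 1) * LorentzNum.plus (fderiv ℝ w x lsig) -
          LorentzNum.plus (fderiv ℝ w x 1) * LorentzNum.minus (fderiv ℝ w x lsig)) / 2 := by
      funext x
      simp only [ldet, LorentzNum.plus_apply, LorentzNum.minus_apply]
      ring
    rw [h3]
    exact (((h2 _ _).mul (h2 _ _)).sub ((h2 _ _).mul (h2 _ _))).div_const 2
  have hVo : IsOpen (B ∩ {x | 0 < ldet (fderiv ℝ w x)}) :=
    hcont.isOpen_inter_preimage hBo isOpen_Ioi
  refine ⟨_, fun x hx => hrU hx.1.1, hVo, ⟨hxB, ?_⟩, w, hws.mono Set.inter_subset_left, ?_⟩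
  · change 0 < ldet (fderiv ℝ w x₀)
    rw [hld x₀ hxB]
    linarith
  · rintro x ⟨hx, hx'⟩
    refine ⟨hx', ?_⟩
    have hxU : x ∈ U := hrU hx.1
    obtain ⟨β₁, γ₁, h₁, e₁⟩ := H₁ x hx.1
    obtain ⟨β₂, γ₂, h₂, e₂⟩ := H₂ x hx.2
    set β := LorentzNum.ofPair (β₁, ε * β₂)
    set γ := LorentzNum.ofPair (γ₁, ε * γ₂)
    have hβγ : β * β + γ * γ = 1 := by
      apply LorentzNum.ext_plus_minus
      · simp [β, γ, LorentzNum.plus_mul, h₁]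
      · simp only [β, γ, map_add, LorentzNum.minus_mul, LorentzNum.minus_ofPair,
          LorentzNum.minus_one]
        linear_combination (β₂ * β₂ + γ₂ * γ₂) * hε + h₂
    refine ⟨(β • qJ + γ • qK) * f x, ?_, fun h => ?_⟩
    · rw [formH_mul, hf.formH_eq_one x hxU, mul_one]
      simpa [formH] using hβγ
    · have hJ : (rightLogDeriv f x h).imJ = fderiv ℝ w x h * β := by
        rw [hwd x hx]
        apply LorentzNum.ext_plus_minus
        · simp [β, LorentzNum.plus_mul, (e₁ h).1, mul_comm]
        · simp only [β, LorentzNum.minus_mul, (e₂ h).1, LorentzNum.minus_ofPair]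
          linear_combination -(β₂ * fderiv ℝ w₂ x h) * hε
      have hK : (rightLogDeriv f x h).imK = fderiv ℝ w x h * γ := by
        rw [hwd x hx]
        apply LorentzNum.ext_plus_minus
        · simp [γ, LorentzNum.plus_mul, (e₁ h).2, mul_comm]
        · simp only [γ, LorentzNum.minus_mul, (e₂ h).2, LorentzNum.minus_ofPair]
          linear_combination -(γ₂ * fderiv ℝ w₂ x h) * hε
      rw [hf.fderiv_eq hxU, hJ, hK, ← smul_mul, smul_add, smul_smul, smul_smul]

end IsLegendrianOn

end LocalCoordinates

/-! ### Charts and orientations -/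

section Orientation

variable {V : Type*} [AddCommGroup V] [Module ℝ V]

theorem isPositivePair_iff {o : Orientation ℝ V (Fin 2)} {u v : V} (h : IsPositivePair o u v)
    (a b c d : ℝ) :
    IsPositivePair o (a • u + b • v) (c • u + d • v) ↔ 0 < a * d - b * c := by
  obtain ⟨B, rfl, rfl, rfl⟩ := h
  have hdet : B.det ![a • B 0 + b • B 1, c • B 0 + d • B 1] = a * d - b * c := by
    rw [Module.Basis.det_apply, Matrix.det_fin_two]
    simp [Module.Basis.toMatrix_apply]
    ring
  constructor
  · rintro ⟨B', h0, h1, ho⟩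
    have h2 := (Module.Basis.orientation_eq_iff_det_pos B B').1 ho.symm
    have : (B' : Fin 2 → V) = ![a • B 0 + b • B 1, c • B 0 + d • B 1] := by
      funext i; fin_cases i <;> simp [h0, h1]
    rwa [this, hdet] at h2
  · intro hpos
    obtain ⟨hl, hs⟩ := (Module.Basis.is_basis_iff_det B).2
      (hdet ▸ (isUnit_iff_ne_zero.2 hpos.ne') :
        IsUnit (B.det ![a • B 0 + b • B 1, c • B 0 + d • B 1]))
    refine ⟨Module.Basis.mk hl hs.ge, by simp, by simp, ?_⟩
    symm
    rw [Module.Basis.orientation_eq_iff_det_pos, Module.Basis.coe_mk, hdet]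
    exact hpos

end Orientation

/-! ### Determinants of real endomorphisms of the Lorentz plane -/

section Ldet

theorem ldet_comp (L L' : LorentzNum →L[ℝ] LorentzNum) : ldet (L ∘L L') = ldet L * ldet L' := by
  have h : ∀ a, L a = a.re • L 1 + a.im • L lsig := fun a => by
    conv_lhs => rw [LorentzNum.eq_add_smul_lsig a]
    rw [map_add, map_smul, map_smul]
  simp only [ldet, ContinuousLinearMap.comp_apply]
  rw [h (L' 1), h (L' lsig)]
  simp
  ring

theorem ldet_id : ldet (ContinuousLinearMap.id ℝ LorentzNum) = 1 := by
  simp [ldet, lsig]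

/-- The determinant of multiplication by `c` is `c` times its conjugate. Among the roots of `c² = 1`
it is positive for `±1` and negative for `±σ`. -/
theorem ldet_mul (c : LorentzNum) (L : LorentzNum →L[ℝ] LorentzNum) (hL : ∀ h, L h = h * c) :
    ldet L = c.re * c.re - c.im * c.im := by
  simp [ldet, hL, lsig]

theorem exists_equiv_of_ldet_pos {L : LorentzNum →L[ℝ] LorentzNum} (h : 0 < ldet L) :
    ∃ e : LorentzNum ≃L[ℝ] LorentzNum, (e : LorentzNum →L[ℝ] LorentzNum) = L ∧
      0 < ldet (e.symm : LorentzNum →L[ℝ] LorentzNum) := by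
  have hinj : Function.Injective L := by
    rw [injective_iff_map_eq_zero]
    intro a ha
    rw [LorentzNum.eq_add_smul_lsig a, map_add, map_smul, map_smul] at ha
    have h1 := congrArg QuadraticAlgebra.re ha
    have h2 := congrArg QuadraticAlgebra.im ha
    simp at h1 h2
    unfold ldet at h
    ext
    · apply (mul_eq_zero.1 (_ : _ * a.re = 0)).resolve_left h.ne'
      linear_combination (L lsig).im * h1 - (L lsig).re * h2
    · apply (mul_eq_zero.1 (_ : _ * a.im = 0)).resolve_left h.ne'
      linear_combination -(L 1).im * h1 + (L 1).re * h2
  let e := (LinearEquiv.ofInjectiveEndo (L : LorentzNum →ₗ[ℝ] LorentzNum)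
    hinj).toContinuousLinearEquiv
  have he : (e : LorentzNum →L[ℝ] LorentzNum) = L := by
    ext1 x; rfl
  refine ⟨e, he, ?_⟩
  have h1 := ldet_comp (e : LorentzNum →L[ℝ] LorentzNum) (e.symm : LorentzNum →L[ℝ] LorentzNum)
  rw [ContinuousLinearEquiv.coe_comp_coe_symm, ldet_id, he] at h1
  exact pos_of_mul_pos_right (h1 ▸ one_pos) h.le

end Ldet

/-! ### Differentials of charts and existence of arc length charts -/

section Charts

open LorentzQuat

variable {M : Type*} [TopologicalSpace M] [ChartedSpace R2 M]

/-- The differential of a chart, as a continuous linear map. -/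
def chartMap (a : OpenPartialHomeomorph LorentzNum M) (z : LorentzNum) : LorentzNum →L[ℝ] R2 :=
  mfderiv 𝓘(ℝ, LorentzNum) 𝓘(ℝ, R2) a z

/-- `(u, v)` is a positive basis of the tangent plane at `p`. -/
def IsPositiveAt (o : ∀ p : M, Orientation ℝ (TangentSpace 𝓘(ℝ, R2) p) (Fin 2)) (p : M)
    (u v : R2) : Prop :=
  IsPositivePair (V := TangentSpace 𝓘(ℝ, R2) p) (o p) u v

theorem isPositiveAt_chartMap_iff {o : ∀ p : M, Orientation ℝ (TangentSpace 𝓘(ℝ, R2) p) (Fin 2)}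
    {a : OpenPartialHomeomorph LorentzNum M} (ha : PreservesOrientation o a) {z : LorentzNum}
    (hz : z ∈ a.source) (L : LorentzNum →L[ℝ] LorentzNum) :
    IsPositiveAt o (a z) (chartMap a z (L 1)) (chartMap a z (L lsig)) ↔ 0 < ldet L := by
  have h : ∀ b : LorentzNum, chartMap a z b = b.re • chartMap a z 1 + b.im • chartMap a z lsig :=
    fun b => by
      conv_lhs => rw [LorentzNum.eq_add_smul_lsig b]
      rw [map_add, map_smul, map_smul]
  rw [h (L 1), h (L lsig)]
  exact isPositivePair_iff (ha z hz) _ _ _ _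

namespace IsSmoothChart

variable {a : OpenPartialHomeomorph LorentzNum M}

theorem mdifferentiableAt (ha : IsSmoothChart a) {z : LorentzNum} (hz : z ∈ a.source) :
    MDifferentiableAt 𝓘(ℝ, LorentzNum) 𝓘(ℝ, R2) a z :=
  (ha.1.contMDiffAt (a.open_source.mem_nhds hz)).mdifferentiableAt (by simp)

theorem mdifferentiableAt_symm (ha : IsSmoothChart a) {p : M} (hp : p ∈ a.target) :
    MDifferentiableAt 𝓘(ℝ, R2) 𝓘(ℝ, LorentzNum) a.symm p :=
  (ha.2.contMDiffAt (a.open_target.mem_nhds hp)).mdifferentiableAt (by simp)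

theorem exists_equiv (ha : IsSmoothChart a) {z : LorentzNum} (hz : z ∈ a.source) :
    ∃ e : LorentzNum ≃L[ℝ] R2, (e : LorentzNum →L[ℝ] R2) = chartMap a z := by
  have hp := a.map_source hz
  have h1 := ha.mdifferentiableAt hz
  have h2 := ha.mdifferentiableAt_symm hp
  let B : R2 →L[ℝ] LorentzNum := mfderiv 𝓘(ℝ, R2) 𝓘(ℝ, LorentzNum) a.symm (a z)
  have hBA : B ∘L chartMap a z = ContinuousLinearMap.id ℝ LorentzNum := by
    have e1 := h2.hasMFDerivAt.comp z h1.hasMFDerivAt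
    have e2 : (a.symm ∘ a) =ᶠ[nhds z] id := by
      filter_upwards [a.open_source.mem_nhds hz] with y hy using a.left_inv hy
    exact hasMFDerivAt_unique (e1.congr_of_eventuallyEq e2.symm) (hasMFDerivAt_id z)
  have hAB : chartMap a z ∘L B = ContinuousLinearMap.id ℝ R2 := by
    have h1' : MDifferentiableAt 𝓘(ℝ, LorentzNum) 𝓘(ℝ, R2) a (a.symm (a z)) := by
      rwa [a.left_inv hz]
    have e1 := h1'.hasMFDerivAt.comp (a z) h2.hasMFDerivAt
    have e2 : (a ∘ a.symm) =ᶠ[nhds (a z)] id := by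
      filter_upwards [a.open_target.mem_nhds hp] with y hy using a.right_inv hy
    have e3 := hasMFDerivAt_unique (e1.congr_of_eventuallyEq e2.symm) (hasMFDerivAt_id (a z))
    have e4 : chartMap a (a.symm (a z)) ∘L B = ContinuousLinearMap.id ℝ R2 := e3
    rwa [a.left_inv hz] at e4
  exact ⟨ContinuousLinearEquiv.equivOfInverse (chartMap a z) B
    (fun x => congrArg (fun L => L x) hBA) (fun x => congrArg (fun L => L x) hAB), rfl⟩

theorem injective (ha : IsSmoothChart a) {z : LorentzNum} (hz : z ∈ a.source) :
    Function.Injective (chartMap a z) := by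
  obtain ⟨e, he⟩ := ha.exists_equiv hz
  rw [← he]
  exact e.injective

theorem surjective (ha : IsSmoothChart a) {z : LorentzNum} (hz : z ∈ a.source) :
    Function.Surjective (chartMap a z) := by
  obtain ⟨e, he⟩ := ha.exists_equiv hz
  rw [← he]
  exact e.surjective

theorem hasFDerivAt_comp (ha : IsSmoothChart a) {V : Type*} [NormedAddCommGroup V]
    [NormedSpace ℝ V] {g : M → V} (hg : ContMDiff 𝓘(ℝ, R2) 𝓘(ℝ, V) ∞ g) {z : LorentzNum}
    (hz : z ∈ a.source) : HasFDerivAt (g ∘ a) (surfDeriv g (a z) ∘L chartMap a z) z :=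
  (((hg (a z)).mdifferentiableAt (by simp)).hasMFDerivAt.comp z
    (ha.mdifferentiableAt hz).hasMFDerivAt).hasFDerivAt

theorem contDiffOn_comp (ha : IsSmoothChart a) {V : Type*} [NormedAddCommGroup V]
    [NormedSpace ℝ V] {g : M → V} (hg : ContMDiff 𝓘(ℝ, R2) 𝓘(ℝ, V) ∞ g) :
    ContDiffOn ℝ ∞ (g ∘ a) a.source :=
  (hg.comp_contMDiffOn ha.1).contDiffOn

end IsSmoothChart

/-- The chain rule for `a = a₀ ∘ τ`, used with `τ` the inverse of a Lorentz coordinate and with `τ`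
affine. -/
theorem chartMap_reparam {a₀ a : OpenPartialHomeomorph LorentzNum M} (ha₀ : IsSmoothChart a₀)
    {τ : LorentzNum → LorentzNum} (hτ : ∀ z ∈ a.source, ContDiffAt ℝ ∞ τ z)
    (h : ∀ z ∈ a.source, τ z ∈ a₀.source ∧ a z = a₀ (τ z)) :
    ContMDiffOn 𝓘(ℝ, LorentzNum) 𝓘(ℝ, R2) ∞ a a.source ∧
      ∀ z ∈ a.source, chartMap a z = chartMap a₀ (τ z) ∘L fderiv ℝ τ z := by
  constructor
  · refine ContMDiffOn.congr (f := a₀ ∘ τ) ?_ fun z hz => (h z hz).2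
    exact ha₀.1.comp (fun z hz => (hτ z hz).contMDiffAt.contMDiffWithinAt) fun z hz => (h z hz).1
  · intro z hz
    have e1 := (ha₀.mdifferentiableAt (h z hz).1).hasMFDerivAt.comp z
      ((hτ z hz).differentiableAt (by simp)).hasFDerivAt.hasMFDerivAt
    have e2 : a =ᶠ[nhds z] a₀ ∘ τ := by
      filter_upwards [a.open_source.mem_nhds hz] with y hy using (h y hy).2
    exact (e1.congr_of_eventuallyEq e2).mfderiv

theorem preservesOrientation_reparam
    {o : ∀ p : M, Orientation ℝ (TangentSpace 𝓘(ℝ, R2) p) (Fin 2)}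
    {a₀ a : OpenPartialHomeomorph LorentzNum M} (ha₀ : IsSmoothChart a₀)
    (ho : PreservesOrientation o a₀)
    {τ : LorentzNum → LorentzNum} (hτ : ∀ z ∈ a.source, ContDiffAt ℝ ∞ τ z)
    (h : ∀ z ∈ a.source, τ z ∈ a₀.source ∧ a z = a₀ (τ z))
    (hpos : ∀ z ∈ a.source, 0 < ldet (fderiv ℝ τ z)) : PreservesOrientation o a := by
  intro z hz
  change IsPositiveAt o (a z) (chartMap a z 1) (chartMap a z lsig)
  rw [(chartMap_reparam ha₀ hτ h).2 z hz, (h z hz).2]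
  exact (isPositiveAt_chartMap_iff ho (h z hz).1 _).2 (hpos z hz)

theorem IsGaussSpinor.isLegendrianOn {g : M → LorentzQuat} {G : M → Bivec}
    (hg : IsGaussSpinor g G)
    (hinj : ∀ p, Function.Injective (mfderiv 𝓘(ℝ, R2) 𝓘(ℝ, LorentzQuat) g p))
    {a : OpenPartialHomeomorph LorentzNum M} (ha : IsSmoothChart a) :
    IsLegendrianOn (g ∘ a) a.source where
  isOpen := a.open_source
  contDiffOn := ha.contDiffOn_comp hg.smooth
  formH_eq_one x _ := hg.formH_eq_one _
  re_eq_zero x hx h := by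
    rw [(ha.hasFDerivAt_comp hg.smooth hx).fderiv]
    exact hg.re_eq_zero _ _
  imI_eq_zero x hx h := by
    rw [(ha.hasFDerivAt_comp hg.smooth hx).fderiv]
    exact hg.imI_eq_zero _ _
  injective x hx h h0 := by
    rw [(ha.hasFDerivAt_comp hg.smooth hx).fderiv] at h0
    have h1 : surfDeriv g (a x) (chartMap a x h) = surfDeriv g (a x) 0 := by
      rw [map_zero]; exact h0
    have h2 : chartMap a x h = chartMap a x 0 := by rw [map_zero]; exact hinj (a x) h1
    exact ha.injective hx h2

/-- In an oriented chart `a₀` a Lorentz coordinate `w` with `d(g ∘ a₀) = q dw` exists locally; the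
inverse function theorem makes `w` the new variable. Orientation is kept because `dw` has positive
determinant. -/
theorem IsGaussSpinor.exists_isArcLengthChart {g : M → LorentzQuat} {G : M → Bivec}
    (hg : IsGaussSpinor g G)
    (hinj : ∀ p, Function.Injective (mfderiv 𝓘(ℝ, R2) 𝓘(ℝ, LorentzQuat) g p))
    (o : SurfaceOrientation M) (p : M) :
    ∃ a : OpenPartialHomeomorph LorentzNum M, p ∈ a.target ∧ IsArcLengthChart o g a := by
  obtain ⟨a₀, hp, ha₀, ho⟩ := o.exists_chart p
  have hL := hg.isLegendrianOn hinj ha₀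
  obtain ⟨V, hVU, hVo, hxV, w, hw, H⟩ := hL.exists_coordinate (a₀.map_target hp)
  set x₀ := a₀.symm p
  have htop : (∞ : WithTop ℕ∞) ≠ 0 := by simp
  have hwd : ∀ x ∈ V, HasFDerivAt w (fderiv ℝ w x) x := fun x hx =>
    ((hw.contDiffAt (hVo.mem_nhds hx)).differentiableAt htop).hasFDerivAt
  obtain ⟨e₀, he₀, -⟩ := exists_equiv_of_ldet_pos (H x₀ hxV).1
  have hx₀d : HasFDerivAt w (e₀ : LorentzNum →L[ℝ] LorentzNum) x₀ := he₀ ▸ hwd x₀ hxV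
  have hw₀ := hw.contDiffAt (hVo.mem_nhds hxV)
  -- The restriction to `V` keeps the positive determinant and the formula for `df` available at
  -- every point of the domain.
  let Φ := (hw₀.toOpenPartialHomeomorph w hx₀d htop).restrOpen V hVo
  have hΦ : ∀ x, Φ x = w x := fun x => rfl
  have hΦV : ∀ x ∈ Φ.source, x ∈ V := fun x hx => hx.2
  have hxΦ : x₀ ∈ Φ.source := ⟨hw₀.mem_toOpenPartialHomeomorph_source hx₀d htop, hxV⟩
  let a := Φ.symm.trans a₀
  have hasrc : ∀ z ∈ a.source, z ∈ Φ.target ∧ Φ.symm z ∈ a₀.source := fun z hz => by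
    simpa [a, OpenPartialHomeomorph.trans_source] using hz
  have hsV : ∀ z ∈ a.source, Φ.symm z ∈ V := fun z hz => hΦV _ (Φ.map_target (hasrc z hz).1)
  have hsymm : ∀ z ∈ a.source, ContDiffAt ℝ ∞ Φ.symm z ∧
      ∃ e : LorentzNum ≃L[ℝ] LorentzNum,
        (e : LorentzNum →L[ℝ] LorentzNum) = fderiv ℝ w (Φ.symm z) ∧
        HasFDerivAt Φ.symm (e.symm : LorentzNum →L[ℝ] LorentzNum) z ∧
        0 < ldet (e.symm : LorentzNum →L[ℝ] LorentzNum) := by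
    intro z hz
    obtain ⟨e, he, hpos⟩ := exists_equiv_of_ldet_pos (H _ (hsV z hz)).1
    have h1 : HasFDerivAt Φ (e : LorentzNum →L[ℝ] LorentzNum) (Φ.symm z) := by
      rw [he]
      exact hwd _ (hsV z hz)
    exact ⟨Φ.contDiffAt_symm (hasrc z hz).1 h1 (hw.contDiffAt (hVo.mem_nhds (hsV z hz))),
      e, he, Φ.hasFDerivAt_symm (hasrc z hz).1 h1, hpos⟩
  have hcomp : ∀ z ∈ a.source, Φ.symm z ∈ a₀.source ∧ a z = a₀ (Φ.symm z) := fun z hz =>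
    ⟨(hasrc z hz).2, rfl⟩
  have hsm : IsSmoothChart a := by
    refine ⟨(chartMap_reparam ha₀ (fun z hz => (hsymm z hz).1) hcomp).1, ?_⟩
    have h1 : ∀ q ∈ a.target, q ∈ a₀.target ∧ a₀.symm q ∈ Φ.source := fun q hq => by
      simpa [a, OpenPartialHomeomorph.trans_target] using hq
    change ContMDiffOn 𝓘(ℝ, R2) 𝓘(ℝ, LorentzNum) ∞ (w ∘ a₀.symm) a.target
    exact hw.contMDiffOn.comp (ha₀.2.mono fun q hq => (h1 q hq).1)
      fun q hq => hΦV _ (h1 q hq).2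
  refine ⟨a, ?_, hsm, ?_, ?_⟩
  · have : a.target = a₀.target ∩ a₀.symm ⁻¹' Φ.source := by
      simp [a]
    rw [this]
    exact ⟨hp, hxΦ⟩
  · refine preservesOrientation_reparam ha₀ ho (fun z hz => (hsymm z hz).1) hcomp fun z hz => ?_
    obtain ⟨-, e, -, h2, hpos⟩ := hsymm z hz
    rwa [h2.fderiv]
  · intro z hz
    obtain ⟨-, e, he, h2, -⟩ := hsymm z hz
    obtain ⟨-, q, hq, hqf⟩ := H _ (hsV z hz)
    have h3 : HasFDerivAt (g ∘ a) _ z :=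
      (hL.contDiffOn.contDiffAt (hL.isOpen.mem_nhds (hasrc z hz).2)
        |>.differentiableAt htop).hasFDerivAt.comp z h2
    have h4 : HasLorentzDerivAt (g ∘ a) q z := by
      refine ⟨_, h3, fun h => ?_⟩
      rw [ContinuousLinearMap.comp_apply, hqf, ← he]
      simp
    rw [← h4.eq_lorentzDeriv]
    exact ⟨h4, hq⟩

end Charts

/-! ### The Lorentz structure and the transition maps of the arc length charts -/

section Transition

open LorentzQuat

variable {M : Type*} [TopologicalSpace M] [ChartedSpace R2 M]
  {g : M → LorentzQuat} {G : M → Bivec} {o : SurfaceOrientation M}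

theorem IsArcLengthChart.surfDeriv_chartMap {a : OpenPartialHomeomorph LorentzNum M}
    (ha : IsArcLengthChart o g a) (hg : ContMDiff 𝓘(ℝ, R2) 𝓘(ℝ, LorentzQuat) ∞ g)
    {z : LorentzNum} (hz : z ∈ a.source) (h : LorentzNum) :
    surfDeriv g (a z) (chartMap a z h) = h • lorentzDeriv (g ∘ a) z := by
  obtain ⟨L, hL, hLq⟩ := (ha.2.2 z hz).1
  rw [← hLq, hL.unique (ha.1.hasFDerivAt_comp hg hz)]
  rfl

/-- Multiplication by `σ` is transported by the differential of the chart; `dg` carries it to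
multiplication by `σ` because `dg = g' da`. -/
theorem exists_endomorphism {a : OpenPartialHomeomorph LorentzNum M}
    (ha : IsArcLengthChart o g a) (hg : ContMDiff 𝓘(ℝ, R2) 𝓘(ℝ, LorentzQuat) ∞ g)
    {p : M} (hp : p ∈ a.target) :
    ∃ T : R2 →ₗ[ℝ] R2, ∀ u, surfDeriv g p (T u) = lsig • surfDeriv g p u := by
  have hz := a.map_target hp
  obtain ⟨e, he⟩ := ha.1.exists_equiv hz
  refine ⟨(e : LorentzNum →ₗ[ℝ] R2) ∘ₗ (LinearMap.mulLeft ℝ lsig) ∘ₗ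
    (e.symm : R2 →ₗ[ℝ] LorentzNum), fun u => ?_⟩
  have h := fun h => ha.surfDeriv_chartMap hg hz h
  rw [a.right_inv hp] at h
  obtain ⟨b, rfl⟩ := e.surjective u
  have he' : ∀ b, e b = chartMap a (a.symm p) b := fun b => by rw [← he]; rfl
  have : ((e : LorentzNum →ₗ[ℝ] R2) ∘ₗ (LinearMap.mulLeft ℝ lsig) ∘ₗ
    (e.symm : R2 →ₗ[ℝ] LorentzNum)) (e b) = e (lsig * b) := by simp
  rw [this, he', he', h, h, smul_smul]

theorem LorentzStructure.eq_of_toFun {S S' : LorentzStructure M} (h : S.toFun = S'.toFun) :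
    S = S' := by
  cases S; cases S'; cases h; rfl

/-- In two arc length charts the differentials of `g` agree up to sign. -/
theorem IsArcLengthChart.exists_sign {a₁ a₂ : OpenPartialHomeomorph LorentzNum M}
    (h₁ : IsArcLengthChart o g a₁) (h₂ : IsArcLengthChart o g a₂)
    (hg : ContMDiff 𝓘(ℝ, R2) 𝓘(ℝ, LorentzQuat) ∞ g) {z₁ z₂ : LorentzNum}
    (hz₁ : z₁ ∈ a₁.source) (hz₂ : z₂ ∈ a₂.source) (hz : a₁ z₁ = a₂ z₂) :
    ∃ s : ℝ, (s = 1 ∨ s = -1) ∧ lorentzDeriv (g ∘ a₁) z₁ = s • lorentzDeriv (g ∘ a₂) z₂ ∧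
      ∀ h, chartMap a₁ z₁ h = chartMap a₂ z₂ (s • h) := by
  obtain ⟨e, he⟩ := h₂.1.exists_equiv hz₂
  have he' : ∀ b, e b = chartMap a₂ z₂ b := fun b => by rw [← he]; rfl
  set L : LorentzNum →L[ℝ] LorentzNum := (e.symm : R2 →L[ℝ] LorentzNum) ∘L chartMap a₁ z₁ with hL
  have hLe : ∀ h, chartMap a₂ z₂ (L h) = chartMap a₁ z₁ h := fun h => by
    rw [← he']; simp [hL]
  set q₁ := lorentzDeriv (g ∘ a₁) z₁
  set q₂ := lorentzDeriv (g ∘ a₂) z₂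
  have hq₁ : formH q₁ q₁ = 1 := (h₁.2.2 z₁ hz₁).2
  have hq₂ : formH q₂ q₂ = 1 := (h₂.2.2 z₂ hz₂).2
  have hLq : ∀ h, L h • q₂ = h • q₁ := fun h => by
    rw [← h₂.surfDeriv_chartMap hg hz₂, ← h₁.surfDeriv_chartMap hg hz₁, hLe, hz]
  -- As `q₂ q₂* = 1`, taking the real part after right multiplication by `q₂*` extracts the
  -- coefficient of `q₂`. Thus `L`, which is `da₂⁻¹ da₁`, is multiplication by `c`.
  set c := (q₁ * star q₂).re
  have hLc : ∀ h, L h = h * c := fun h => by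
    have e1 := congrArg (fun q => (q * star q₂).re) (hLq h)
    simp only [smul_mul, mul_star_of_formH hq₂] at e1
    simpa [c] using e1
  have hc : c • q₂ = q₁ := by
    have := hLq 1
    rwa [hLc, one_mul, one_smul] at this
  have hcc : c * c = 1 := by
    rw [← hq₁, ← hc, formH_smul, hq₂, mul_one]
  have hpos : 0 < ldet L := by
    rw [← isPositiveAt_chartMap_iff h₂.2.1 hz₂, hLe, hLe, ← hz]
    exact h₁.2.1 z₁ hz₁
  rw [ldet_mul c L hLc] at hpos
  have e1 := congrArg QuadraticAlgebra.re hcc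
  have e2 := congrArg QuadraticAlgebra.im hcc
  simp at e1 e2
  -- `c² = 1` forces one of the two parts of `c` to vanish; a vanishing real part would make the
  -- determinant of `L` nonpositive.
  have him : c.im = 0 := by
    have : c.re * c.im = 0 := by linarith
    rcases mul_eq_zero.1 this with h | h
    · nlinarith [mul_self_nonneg c.im]
    · exact h
  have hcre : c = c.re • (1 : LorentzNum) := by
    ext <;> simp [him]
  refine ⟨c.re, mul_self_eq_one_iff.1 (by rw [him] at e1; linarith), ?_, fun h => ?_⟩
  · rw [← hc]
    conv_lhs => rw [hcre]
    rw [smul_assoc, one_smul]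
  · rw [← hLe, hLc]
    conv_lhs => rw [hcre]
    rw [mul_smul_comm, mul_one]

/-- The derivative of the transition map is `±id` at every point and continuous, so its sign is
locally constant. The derivative is part of the conclusion so that the sign is recorded by a
function defined without choices. -/
theorem IsArcLengthChart.eventually_eq {a₁ a₂ : OpenPartialHomeomorph LorentzNum M}
    (h₁ : IsArcLengthChart o g a₁) (h₂ : IsArcLengthChart o g a₂)
    (hg : ContMDiff 𝓘(ℝ, R2) 𝓘(ℝ, LorentzQuat) ∞ g) {p₀ : M} (hp₁ : p₀ ∈ a₁.target)
    (hp₂ : p₀ ∈ a₂.target) :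
    ∃ (s : ℝ) (b : LorentzNum), (s = 1 ∨ s = -1) ∧ ∀ᶠ p in nhds p₀,
      fderiv ℝ (a₂.symm ∘ a₁) (a₁.symm p) 1 = s • (1 : LorentzNum) ∧
        a₂.symm p = s • a₁.symm p + b := by
  set T : LorentzNum → LorentzNum := a₂.symm ∘ a₁ with hT
  set W := a₁.source ∩ a₁ ⁻¹' a₂.target
  have hWo : IsOpen W := a₁.isOpen_inter_preimage a₂.open_target
  have hTs : ContDiffOn ℝ ∞ T W :=
    (h₂.1.2.comp (h₁.1.1.mono Set.inter_subset_left) fun z hz => hz.2).contDiffOn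
  have hsign : ∀ z ∈ W, ∃ s : ℝ, (s = 1 ∨ s = -1) ∧
      HasFDerivAt T (s • ContinuousLinearMap.id ℝ LorentzNum) z := by
    intro z hz
    have hTz : T z ∈ a₂.source := a₂.map_target hz.2
    have haz : a₁ z = a₂ (T z) := (a₂.right_inv hz.2).symm
    obtain ⟨s, hs, -, hsm⟩ := h₁.exists_sign h₂ hg hz.1 hTz haz
    refine ⟨s, hs, ?_⟩
    have hTd := ((hTs.contDiffAt (hWo.mem_nhds hz)).differentiableAt (by simp)).hasFDerivAt
    have e1 := (h₂.1.mdifferentiableAt hTz).hasMFDerivAt.comp z hTd.hasMFDerivAt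
    have e2 : a₁ =ᶠ[nhds z] a₂ ∘ T := by
      filter_upwards [hWo.mem_nhds hz] with y hy using (a₂.right_inv hy.2).symm
    have e3 : chartMap a₁ z = chartMap a₂ (T z) ∘L fderiv ℝ T z :=
      (e1.congr_of_eventuallyEq e2).mfderiv
    have e4 : fderiv ℝ T z = s • ContinuousLinearMap.id ℝ LorentzNum := by
      ext1 h
      apply h₂.1.injective hTz
      have := congrArg (fun L => L h) e3
      rw [ContinuousLinearMap.comp_apply] at this
      rw [← this, hsm]
      rfl
    rwa [e4] at hTd
  set z₀ := a₁.symm p₀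
  have hz₀ : z₀ ∈ W := ⟨a₁.map_target hp₁, by
    change a₁ (a₁.symm p₀) ∈ a₂.target
    rwa [a₁.right_inv hp₁]⟩
  obtain ⟨s, hs, hTs₀⟩ := hsign z₀ hz₀
  have hcont : ContinuousAt (fun z => (fderiv ℝ T z 1).re) z₀ := by
    have e1 : ContinuousAt (fderiv ℝ T) z₀ :=
      (hTs.continuousOn_fderiv_of_isOpen hWo (by simp)).continuousAt (hWo.mem_nhds hz₀)
    have e2 : ContinuousAt (fun z => (1 / 2 : ℝ) * (LorentzNum.plus (fderiv ℝ T z 1) +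
        LorentzNum.minus (fderiv ℝ T z 1))) z₀ :=
      continuousAt_const.mul ((LorentzNum.plus.continuous.continuousAt.comp
        (e1.clm_apply continuousAt_const)).add
        (LorentzNum.minus.continuous.continuousAt.comp (e1.clm_apply continuousAt_const)))
    refine e2.congr (Filter.Eventually.of_forall fun z => ?_)
    simp only [LorentzNum.plus_apply, LorentzNum.minus_apply]
    ring
  have hre : ∀ (t : ℝ) z, HasFDerivAt T (t • ContinuousLinearMap.id ℝ LorentzNum) z →
      (fderiv ℝ T z 1).re = t := fun t z h => by
    rw [h.fderiv]; simp
  -- Among the two possible signs, being different from `-s` is an open condition that singles out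
  -- `s`.
  have hne : ∀ᶠ z in nhds z₀, (fderiv ℝ T z 1).re ≠ -s := by
    apply hcont.eventually_ne
    rw [hre s z₀ hTs₀]
    rcases hs with rfl | rfl <;> norm_num
  obtain ⟨r, hr, hrW⟩ := Metric.mem_nhds_iff.1 (Filter.inter_mem (hWo.mem_nhds hz₀) hne)
  have hball : ∀ z ∈ Metric.ball z₀ r,
      HasFDerivAt T (s • ContinuousLinearMap.id ℝ LorentzNum) z := by
    intro z hz
    obtain ⟨t, ht, h⟩ := hsign z (hrW hz).1
    have h2 : (fderiv ℝ T z 1).re ≠ -s := (hrW hz).2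
    rw [hre t z h] at h2
    have : t = s := by
      rcases hs with rfl | rfl <;> rcases ht with rfl | rfl <;> simp_all
    rwa [this] at h
  have hconst : ∀ z ∈ Metric.ball z₀ r, T z - s • z = T z₀ - s • z₀ := by
    intro z hz
    have hd : ∀ y ∈ Metric.ball z₀ r, HasFDerivAt (fun y => T y - s • y)
        (0 : LorentzNum →L[ℝ] LorentzNum) y := fun y hy => by
      have := (hball y hy).sub ((hasFDerivAt_id y).const_smul s)
      rwa [sub_self] at this
    exact (convex_ball z₀ r).is_const_of_fderivWithin_eq_zero
      (fun y hy => (hd y hy).differentiableAt.differentiableWithinAt)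
      (fun y hy => by
        rw [fderivWithin_of_isOpen Metric.isOpen_ball hy, (hd y hy).fderiv])
      hz (Metric.mem_ball_self hr)
  refine ⟨s, T z₀ - s • z₀, hs, ?_⟩
  filter_upwards [(a₁.continuousAt_symm hp₁).preimage_mem_nhds (Metric.ball_mem_nhds z₀ hr),
    a₁.open_target.mem_nhds hp₁] with p hp hpt
  refine ⟨by rw [(hball _ hp).fderiv]; simp, ?_⟩
  rw [← hconst _ hp]
  simp [hT, a₁.right_inv hpt]

theorem smul_eq_mul_of_sign (s : ℝ) (z : LorentzNum) : s • z = (s • (1 : LorentzNum)) * z := by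
  rw [smul_mul_assoc, one_mul]

/-- Two arc length charts differ by a map `z ↦ ± z + b` on a connected part of their overlap. -/
theorem IsArcLengthChart.exists_affine {a₁ a₂ : OpenPartialHomeomorph LorentzNum M}
    (h₁ : IsArcLengthChart o g a₁) (h₂ : IsArcLengthChart o g a₂)
    (hg : ContMDiff 𝓘(ℝ, R2) 𝓘(ℝ, LorentzQuat) ∞ g) {C : Set M}
    (hC : C ⊆ a₁.target ∩ a₂.target) (hCc : IsPreconnected C) :
    ∃ ε b : LorentzNum, (ε = 1 ∨ ε = -1) ∧ ∀ p ∈ C, a₂.symm p = ε * a₁.symm p + b := by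
  rcases C.eq_empty_or_nonempty with rfl | ⟨p₀, hp₀⟩
  · exact ⟨1, 0, Or.inl rfl, fun p hp => hp.elim⟩
  -- The sign and the translation are both expressed as functions of the point; the pair is locally
  -- constant on `C`, hence constant.
  let c : M → LorentzNum := fun p => fderiv ℝ (a₂.symm ∘ a₁) (a₁.symm p) 1
  let Φ : C → LorentzNum × LorentzNum := fun p => (c p, a₂.symm p - c p * a₁.symm p)
  have hΦ : IsLocallyConstant Φ := by
    rw [IsLocallyConstant.iff_eventually_eq]
    rintro ⟨p, hp⟩
    obtain ⟨s, b, -, hev⟩ := h₁.eventually_eq h₂ hg (hC hp).1 (hC hp).2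
    have key : ∀ q : C, (fderiv ℝ (a₂.symm ∘ a₁) (a₁.symm q) 1 = s • (1 : LorentzNum) ∧
        a₂.symm q = s • a₁.symm q + b) → Φ q = (s • (1 : LorentzNum), b) := by
      rintro q ⟨e1, e2⟩
      simp only [Φ, c, e1, e2, ← smul_eq_mul_of_sign, add_sub_cancel_left]
    have h1 := key ⟨p, hp⟩ hev.self_of_nhds
    filter_upwards [continuous_subtype_val.continuousAt.eventually hev] with q hq
    rw [h1, key q hq]
  have : PreconnectedSpace C := isPreconnected_iff_preconnectedSpace.1 hCc
  obtain ⟨s, b, hs, hev⟩ := h₁.eventually_eq h₂ hg (hC hp₀).1 (hC hp₀).2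
  refine ⟨c p₀, a₂.symm p₀ - c p₀ * a₁.symm p₀, ?_, fun p hp => ?_⟩
  · have := hev.self_of_nhds.1
    simp only [c, this]
    rcases hs with rfl | rfl
    · left; rw [one_smul]
    · right; rw [neg_smul, one_smul]
  · have h := hΦ.apply_eq_of_preconnectedSpace ⟨p, hp⟩ ⟨p₀, hp₀⟩
    have e1 : c p = c p₀ := congrArg Prod.fst h
    have e2 : a₂.symm p - c p * a₁.symm p = a₂.symm p₀ - c p₀ * a₁.symm p₀ := congrArg Prod.snd h
    rw [← e2, e1, add_sub_cancel]

/-- A map `z ↦ ± z + b` transforms arc length charts into arc length charts. -/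
theorem IsArcLengthChart.of_affine {a₁ a₂ : OpenPartialHomeomorph LorentzNum M}
    (h₁ : IsArcLengthChart o g a₁)
    (ht : a₂.target ⊆ a₁.target) {s : ℝ} {b : LorentzNum} (hs : s * s = 1)
    (h : ∀ p ∈ a₂.target, a₂.symm p = s • a₁.symm p + b) : IsArcLengthChart o g a₂ := by
  -- This is the inverse of `z ↦ s z + b`, since `s² = 1`.
  set τ : LorentzNum → LorentzNum := fun z => s • (z - b) with hτ
  have hτs : ContDiff ℝ ∞ τ := (contDiff_id.sub contDiff_const).const_smul s
  have hτd : ∀ z, HasFDerivAt τ (s • ContinuousLinearMap.id ℝ LorentzNum) z := fun z =>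
    ((hasFDerivAt_id z).sub_const b).const_smul s
  have hcomp : ∀ z ∈ a₂.source, τ z ∈ a₁.source ∧ a₂ z = a₁ (τ z) := by
    intro z hz
    have hp := a₂.map_source hz
    have e1 : τ z = a₁.symm (a₂ z) := by
      have := h _ hp
      rw [a₂.left_inv hz] at this
      change s • (z - b) = _
      rw [sub_eq_iff_eq_add.2 this, smul_smul, hs, one_smul]
    rw [e1]
    exact ⟨a₁.map_target (ht hp), (a₁.right_inv (ht hp)).symm⟩
  refine ⟨⟨(chartMap_reparam h₁.1 (fun z _ => hτs.contDiffAt) hcomp).1, ?_⟩,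
    preservesOrientation_reparam h₁.1 h₁.2.1 (fun z _ => hτs.contDiffAt) hcomp fun z _ => ?_,
    fun z hz => ?_⟩
  · have e1 : ContDiff ℝ ∞ fun z : LorentzNum => s • z + b :=
      (contDiff_id.const_smul s).add contDiff_const
    exact (e1.contMDiff.comp_contMDiffOn (h₁.1.2.mono ht)).congr h
  · rw [(hτd z).fderiv, ldet_mul (s • (1 : LorentzNum)) _ fun h => by simp]
    simp [hs]
  · obtain ⟨⟨L, hL, hLq⟩, hq⟩ := h₁.2.2 (τ z) (hcomp z hz).1
    have e1 : HasLorentzDerivAt (g ∘ a₂) (s • lorentzDeriv (g ∘ a₁) (τ z)) z := by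
      refine ⟨L ∘L (s • ContinuousLinearMap.id ℝ LorentzNum), ?_, fun h => ?_⟩
      · refine (hL.comp z (hτd z)).congr_of_eventuallyEq ?_
        filter_upwards [a₂.open_source.mem_nhds hz] with y hy
        simp [(hcomp y hy).2]
      · rw [ContinuousLinearMap.comp_apply, hLq]
        simp only [smul_apply, ContinuousLinearMap.id_apply]
        rw [smul_assoc, smul_comm]
    rw [← e1.eq_lorentzDeriv]
    refine ⟨e1, ?_⟩
    rw [← one_smul LorentzNum (lorentzDeriv (g ∘ a₁) (τ z)), ← smul_assoc, formH_smul, hq]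
    simp [smul_smul, hs]

end Transition

/-! ### The angle function -/

section Angle

open LorentzQuat

/-- A map from a simply connected, locally path connected space to the circle lifts through the
covering `ℝ → Circle`. -/
theorem exists_continuous_arg {X : Type*} [TopologicalSpace X] [SimplyConnectedSpace X]
    [LocallyPathConnectedSpace X] {Z : X → ℂ} (hZ : Continuous Z) (hZ1 : ∀ x, ‖Z x‖ = 1) :
    ∃ Φ : X → ℝ, Continuous Φ ∧ ∀ x, Z x = Complex.exp (Φ x * Complex.I) := by
  have hmem : ∀ x, Z x ∈ Submonoid.unitSphere ℂ := fun x => mem_sphere_zero_iff_norm.2 (hZ1 x)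
  let f : C(X, Circle) := ⟨fun x => (⟨Z x, hmem x⟩ : Circle), hZ.subtype_mk hmem⟩
  let x₀ : X := Classical.arbitrary X
  obtain ⟨t, ht⟩ := Circle.exp_surjective (f x₀)
  obtain ⟨Φ, ⟨-, hΦ⟩, -⟩ := Circle.isCoveringMap_exp.existsUnique_continuousMap_lifts f x₀ t ht
  refine ⟨Φ, Φ.continuous, fun x => ?_⟩
  rw [← Circle.coe_exp]
  exact (congrArg (fun z : Circle => (z : ℂ)) (congrFun hΦ x)).symm

/-- Near `x` one has `ψ y = ψ x + arcsin (sin (ψ y - ψ x))`, where the sine is smooth by the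
subtraction formula. Continuity keeps `ψ y - ψ x` in the range where `arcsin` inverts `sin`. -/
theorem contDiffOn_of_cos_sin {E : Type*} [NormedAddCommGroup E] [NormedSpace ℝ E] {U : Set E}
    (hU : IsOpen U) {ψ : E → ℝ} (hψ : ContinuousOn ψ U)
    (hc : ContDiffOn ℝ ∞ (fun x => Real.cos (ψ x)) U)
    (hs : ContDiffOn ℝ ∞ (fun x => Real.sin (ψ x)) U) : ContDiffOn ℝ ∞ ψ U := by
  intro x hx
  apply ContDiffAt.contDiffWithinAt
  have hcx := hc.contDiffAt (hU.mem_nhds hx)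
  have hsx := hs.contDiffAt (hU.mem_nhds hx)
  have hψx := hψ.continuousAt (hU.mem_nhds hx)
  have h1 : ContDiffAt ℝ ∞ (fun y => Real.sin (ψ y - ψ x)) x := by
    simp only [Real.sin_sub]
    exact (hsx.mul contDiffAt_const).sub (hcx.mul contDiffAt_const)
  have h2 : ContDiffAt ℝ ∞ (fun y => Real.arcsin (Real.sin (ψ y - ψ x)) + ψ x) x := by
    have h0 : ContDiffAt ℝ ∞ Real.arcsin (Real.sin (ψ x - ψ x)) :=
      Real.contDiffAt_arcsin (by simp) (by simp)
    exact (h0.comp x h1).add contDiffAt_const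
  refine h2.congr_of_eventuallyEq ?_
  have h3 : ContinuousAt (fun y => ψ y - ψ x) x := hψx.sub continuousAt_const
  have h4 : ∀ᶠ y in nhds x, ψ y - ψ x ∈ Set.Ioo (-(Real.pi / 2)) (Real.pi / 2) := by
    apply h3.eventually_mem
    rw [sub_self]
    exact Ioo_mem_nhds (by linarith [Real.pi_pos]) (by linarith [Real.pi_pos])
  filter_upwards [h4] with y hy
  rw [Real.arcsin_sin hy.1.le hy.2.le, sub_add_cancel]

theorem fderiv_eq_of_cos_sin {E : Type*} [NormedAddCommGroup E] [NormedSpace ℝ E] {ψ : E → ℝ}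
    {x : E} (hψ : DifferentiableAt ℝ ψ x) (h : E) :
    fderiv ℝ ψ x h = Real.cos (ψ x) * fderiv ℝ (fun y => Real.sin (ψ y)) x h -
      Real.sin (ψ x) * fderiv ℝ (fun y => Real.cos (ψ y)) x h := by
  rw [hψ.hasFDerivAt.sin.fderiv, hψ.hasFDerivAt.cos.fderiv]
  simp only [smul_apply, smul_eq_mul]
  linear_combination (-(fderiv ℝ ψ x h)) * Real.sin_sq_add_cos_sq (ψ x)

/-- If the square of a unit complex function has a continuous argument, so has the function. -/
theorem exists_continuousOn_arg_of_sq {X : Type*} [TopologicalSpace X] {U : Set X}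
    {ζ : X → ℂ} (hζ : ContinuousOn ζ U) {Φ : X → ℝ} (hΦ : ContinuousOn Φ U)
    (h : ∀ x ∈ U, ζ x ^ 2 = Complex.exp (Φ x * Complex.I)) :
    ∃ ψ : X → ℝ, ContinuousOn ψ U ∧ ∀ x ∈ U, ζ x = Complex.exp (ψ x * Complex.I) := by
  -- The quotient of `ζ` by the candidate root `exp (iΦ/2)` is continuous with values `±1` on `U`.
  set δ : X → ℂ := fun x => ζ x * Complex.exp (-(Φ x / 2 : ℝ) * Complex.I) with hδ
  have hδc : ContinuousOn δ U := hζ.mul (Complex.continuous_exp.comp_continuousOn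
    ((Complex.continuous_ofReal.comp_continuousOn (hΦ.div_const 2)).neg.mul continuousOn_const))
  have hζδ : ∀ x, ζ x = δ x * Complex.exp ((Φ x / 2 : ℝ) * Complex.I) := fun x => by
    simp only [hδ]
    rw [mul_assoc, ← Complex.exp_add]
    simp
  have hδ1 : ∀ x ∈ U, δ x = 1 ∨ δ x = -1 := fun x hx => by
    rw [← sq_eq_sq_iff_eq_or_eq_neg, one_pow]
    simp only [hδ]
    rw [mul_pow, h x hx, ← Complex.exp_nat_mul, ← Complex.exp_add]
    convert Complex.exp_zero using 2
    push_cast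
    ring

  -- The correction is `0` where `δ = 1` and `π` where `δ = -1`; written through `re δ` it is
  -- visibly continuous, with no connectedness of `U`.
  refine ⟨fun x => Φ x / 2 + Real.pi * (1 - (δ x).re) / 2, ?_, fun x hx => ?_⟩
  · exact (hΦ.div_const 2).add ((continuousOn_const.mul (continuousOn_const.sub
      (Complex.continuous_re.comp_continuousOn hδc))).div_const 2)
  · rw [hζδ x]
    beta_reduce
    rcases hδ1 x hx with h1 | h1 <;> rw [h1]
    · simp
    · have : ((Φ x / 2 + Real.pi * (1 - (-1 : ℂ).re) / 2 : ℝ) : ℂ) * Complex.I =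
          (Φ x / 2 : ℝ) * Complex.I + Real.pi * Complex.I := by
        simp
        ring
      rw [this, Complex.exp_add, Complex.exp_pi_mul_I]
      ring

/-- Only the square is assumed to have an argument: it is the square that lives on the simply
connected surface, while `U` may have any topology. -/
theorem exists_contDiffOn_angle {E : Type*} [NormedAddCommGroup E] [NormedSpace ℝ E] {U : Set E}
    (hU : IsOpen U) {β γ : E → ℝ} (hβ : ContDiffOn ℝ ∞ β U) (hγ : ContDiffOn ℝ ∞ γ U) {Φ : E → ℝ}
    (hΦ : ContinuousOn Φ U)
    (h : ∀ x ∈ U, (β x + γ x * Complex.I) ^ 2 = Complex.exp (Φ x * Complex.I)) :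
    ∃ ψ : E → ℝ, ContDiffOn ℝ ∞ ψ U ∧ (∀ x ∈ U, β x = Real.cos (ψ x) ∧ γ x = Real.sin (ψ x)) ∧
      ∀ x ∈ U, ∀ u, fderiv ℝ ψ x u = β x * fderiv ℝ γ x u - γ x * fderiv ℝ β x u := by
  have hζ : ContinuousOn (fun x => (β x + γ x * Complex.I : ℂ)) U :=
    (Complex.continuous_ofReal.comp_continuousOn hβ.continuousOn).add
      ((Complex.continuous_ofReal.comp_continuousOn hγ.continuousOn).mul continuousOn_const)
  obtain ⟨ψ, hψ, he⟩ := exists_continuousOn_arg_of_sq hζ hΦ h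
  have hcs : ∀ x ∈ U, β x = Real.cos (ψ x) ∧ γ x = Real.sin (ψ x) := by
    intro x hx
    have h1 := he x hx
    constructor
    · have := congrArg Complex.re h1
      rw [Complex.exp_ofReal_mul_I_re] at this
      simpa using this
    · have := congrArg Complex.im h1
      rw [Complex.exp_ofReal_mul_I_im] at this
      simpa using this
  have hψs : ContDiffOn ℝ ∞ ψ U := contDiffOn_of_cos_sin hU hψ
    (hβ.congr fun x hx => (hcs x hx).1.symm) (hγ.congr fun x hx => (hcs x hx).2.symm)
  refine ⟨ψ, hψs, hcs, fun x hx u => ?_⟩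
  have e1 : β =ᶠ[nhds x] fun y => Real.cos (ψ y) := by
    filter_upwards [hU.mem_nhds hx] with y hy using (hcs y hy).1
  have e2 : γ =ᶠ[nhds x] fun y => Real.sin (ψ y) := by
    filter_upwards [hU.mem_nhds hx] with y hy using (hcs y hy).2
  rw [e1.fderiv_eq, e2.fderiv_eq, (hcs x hx).1, (hcs x hx).2]
  exact fderiv_eq_of_cos_sin ((hψs.contDiffAt (hU.mem_nhds hx)).differentiableAt (by simp)) u

end Angle

/-! ### The direction `g' g⁻¹` in an arc length chart and its angle -/

section Direction

open LorentzQuat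

variable {M : Type*} [TopologicalSpace M] [ChartedSpace R2 M]
  {g : M → LorentzQuat} {G : M → Bivec} {o : SurfaceOrientation M}

/-- The quaternion `g' g⁻¹` in a chart. -/
def chartLogDeriv (g : M → LorentzQuat) (a : OpenPartialHomeomorph LorentzNum M) (z : LorentzNum) :
    LorentzQuat :=
  lorentzDeriv (g ∘ a) z * star (g (a z))

theorem IsArcLengthChart.contDiffOn_chartLogDeriv {a : OpenPartialHomeomorph LorentzNum M}
    (ha : IsArcLengthChart o g a) (hg : ContMDiff 𝓘(ℝ, R2) 𝓘(ℝ, LorentzQuat) ∞ g) :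
    ContDiffOn ℝ ∞ (chartLogDeriv g a) a.source :=
  (contDiffOn_rightLogDeriv a.open_source (ha.1.contDiffOn_comp hg)).clm_apply contDiffOn_const

/-- The second derivative of `g ∘ a` is Lorentz-linear in its second argument because `dg = g' da`,
hence in the first by symmetry. Quaternionic conjugation is Lorentz-linear too, so the derivative of
`g' g⁻¹` inherits the property. -/
theorem IsArcLengthChart.fderiv_chartLogDeriv {a : OpenPartialHomeomorph LorentzNum M}
    (ha : IsArcLengthChart o g a) (hg : ContMDiff 𝓘(ℝ, R2) 𝓘(ℝ, LorentzQuat) ∞ g) {z : LorentzNum}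
    (hz : z ∈ a.source) (h : LorentzNum) :
    fderiv ℝ (chartLogDeriv g a) z h = h • fderiv ℝ (chartLogDeriv g a) z 1 := by
  have htop : (∞ : WithTop ℕ∞) ≠ 0 := by simp
  have hf := ha.1.contDiffOn_comp hg
  have hfz := hf.contDiffAt (a.open_source.mem_nhds hz)
  have hfd := (hfz.differentiableAt htop).hasFDerivAt
  have hfdd := (((hf.fderiv_of_isOpen a.open_source (m := ∞) (by simp)).contDiffAt
    (a.open_source.mem_nhds hz)).differentiableAt htop).hasFDerivAt
  have hfq : ∀ y ∈ a.source, ∀ k, fderiv ℝ (g ∘ a) y k = k • fderiv ℝ (g ∘ a) y 1 := by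
    intro y hy k
    obtain ⟨L, hL, hLq⟩ := (ha.2.2 y hy).1
    rw [hL.fderiv, hLq, hLq, one_smul]
  have hD : ∀ h k, fderiv ℝ (fderiv ℝ (g ∘ a)) z h k =
      k • fderiv ℝ (fderiv ℝ (g ∘ a)) z h 1 := by
    intro h k
    have e1 := (smulL k).hasFDerivAt.comp z (hfdd.clm_eval 1)
    have e2 : (fun y => fderiv ℝ (g ∘ a) y k) =ᶠ[nhds z] smulL k ∘ fun y => fderiv ℝ (g ∘ a) y 1 := by
      filter_upwards [a.open_source.mem_nhds hz] with y hy using hfq y hy k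
    exact congrArg (fun L => L h) ((hfdd.clm_eval k).unique (e1.congr_of_eventuallyEq e2))
  have hsymm : ∀ h, fderiv ℝ (fderiv ℝ (g ∘ a)) z h 1 =
      h • fderiv ℝ (fderiv ℝ (g ∘ a)) z 1 1 := by
    intro h
    rw [(hfz.isSymmSndFDerivAt (by
      simpa using WithTop.coe_le_coe.2 (le_top : (2 : ℕ∞) ≤ ⊤))).eq h 1, hD]
  have key : ∀ h, fderiv ℝ (chartLogDeriv g a) z h =
      h • (fderiv ℝ (g ∘ a) z 1 * star (fderiv ℝ (g ∘ a) z 1) +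
        fderiv ℝ (fderiv ℝ (g ∘ a)) z 1 1 * star (g (a z))) := by
    intro h
    have e1 : HasFDerivAt (chartLogDeriv g a) _ z :=
      hasFDerivAt_mul (hfdd.clm_eval 1) (hasFDerivAt_star hfd)
    rw [e1.fderiv]
    change fderiv ℝ (g ∘ a) z 1 * star (fderiv ℝ (g ∘ a) z h) +
      fderiv ℝ (fderiv ℝ (g ∘ a)) z h 1 * star (g (a z)) = _
    rw [hsymm h, hfq z hz h, star_smul', mul_smul', smul_mul, smul_add]
  rw [key h, key 1, one_smul]

theorem IsGaussSpinor.chartLogDeriv_eq (hG : IsGaussSpinor g G)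
    {a : OpenPartialHomeomorph LorentzNum M}
    (ha : IsArcLengthChart o g a) {z : LorentzNum} (hz : z ∈ a.source) :
    chartLogDeriv g a z = (chartLogDeriv g a z).imJ • qJ + (chartLogDeriv g a z).imK • qK ∧
      (chartLogDeriv g a z).imJ * (chartLogDeriv g a z).imJ +
        (chartLogDeriv g a z).imK * (chartLogDeriv g a z).imK = 1 := by
  have h1 : lorentzDeriv (g ∘ a) z = surfDeriv g (a z) (chartMap a z 1) := by
    rw [ha.surfDeriv_chartMap hG.smooth hz, one_smul]
  have hre : (chartLogDeriv g a z).re = 0 := by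
    rw [chartLogDeriv, h1]; exact hG.re_eq_zero _ _
  have hI : (chartLogDeriv g a z).imI = 0 := by
    rw [chartLogDeriv, h1]; exact hG.imI_eq_zero _ _
  have hH : formH (chartLogDeriv g a z) (chartLogDeriv g a z) = 1 := by
    rw [chartLogDeriv, formH_mul, formH_star, hG.formH_eq_one, mul_one, (ha.2.2 z hz).2]
  constructor
  · ext1
    · rw [hre]; simp
    · rw [hI]; simp
    · simp
    · simp
  · rw [formH, hre, hI] at hH
    simpa using hH

/-- The square of the direction of `dg g⁻¹`, which does not depend on the arc length chart. -/
def directionSq (ρ : LorentzNum →L[ℝ] ℝ) (g : M → LorentzQuat)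
    (a : OpenPartialHomeomorph LorentzNum M) (z : LorentzNum) : ℂ :=
  (ρ (chartLogDeriv g a z).imJ + ρ (chartLogDeriv g a z).imK * Complex.I) ^ 2

theorem IsGaussSpinor.directionSq_eq (hG : IsGaussSpinor g G)
    {a₁ a₂ : OpenPartialHomeomorph LorentzNum M}
    (h₁ : IsArcLengthChart o g a₁) (h₂ : IsArcLengthChart o g a₂) (ρ : LorentzNum →L[ℝ] ℝ)
    {z₁ z₂ : LorentzNum} (hz₁ : z₁ ∈ a₁.source) (hz₂ : z₂ ∈ a₂.source) (hz : a₁ z₁ = a₂ z₂) :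
    directionSq ρ g a₁ z₁ = directionSq ρ g a₂ z₂ := by
  obtain ⟨s, hs, hq, -⟩ := h₁.exists_sign h₂ hG.smooth hz₁ hz₂ hz
  have h : chartLogDeriv g a₁ z₁ = s • chartLogDeriv g a₂ z₂ := by
    rw [chartLogDeriv, hq, hz, chartLogDeriv, ← mulL_apply, map_smul]
    rfl
  rw [directionSq, h]
  have hJ : ρ (s • chartLogDeriv g a₂ z₂).imJ = s * ρ (chartLogDeriv g a₂ z₂).imJ :=
    (ρ ∘L imJL).map_smul s _
  have hK : ρ (s • chartLogDeriv g a₂ z₂).imK = s * ρ (chartLogDeriv g a₂ z₂).imK :=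
    (ρ ∘L imKL).map_smul s _
  rw [hJ, hK]
  rcases hs with rfl | rfl
  · simp [directionSq]
  · simp [directionSq]; ring

/-- A continuous choice of twice the angle of `dg g⁻¹`. -/
theorem IsGaussSpinor.exists_double_angle (hG : IsGaussSpinor g G)
    [SimplyConnectedSpace M]
    (hch : ∀ p, ∃ a : OpenPartialHomeomorph LorentzNum M, p ∈ a.target ∧ IsArcLengthChart o g a)
    {ρ : LorentzNum →L[ℝ] ℝ} (hρ : ∀ a b, ρ (a * b) = ρ a * ρ b) (hρ1 : ρ 1 = 1) :
    ∃ Φ : M → ℝ, Continuous Φ ∧ ∀ a : OpenPartialHomeomorph LorentzNum M,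
      IsArcLengthChart o g a → ∀ z ∈ a.source,
        directionSq ρ g a z = Complex.exp (Φ (a z) * Complex.I) := by
  choose c hc hca using hch
  have hlpc : LocallyPathConnectedSpace M := ChartedSpace.locallyPathConnectedSpace R2 M
  -- The chosen charts vary arbitrarily with `p`; continuity holds because near `p` the value can be
  -- computed in the single chart `c p`.
  let Z : M → ℂ := fun p => directionSq ρ g (c p) ((c p).symm p)
  have hZ : ∀ a : OpenPartialHomeomorph LorentzNum M, IsArcLengthChart o g a → ∀ z ∈ a.source,
      directionSq ρ g a z = Z (a z) := fun a ha z hz =>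
    hG.directionSq_eq ha (hca (a z)) ρ hz ((c (a z)).map_target (hc (a z)))
      ((c (a z)).right_inv (hc (a z))).symm
  have hZc : Continuous Z := by
    rw [continuous_iff_continuousAt]
    intro p
    have hz := (c p).map_target (hc p)
    have hn : ContinuousAt (chartLogDeriv g (c p)) ((c p).symm p) :=
      ((hca p).contDiffOn_chartLogDeriv hG.smooth).continuousOn.continuousAt
        ((c p).open_source.mem_nhds hz)
    have h1 : ContinuousAt (directionSq ρ g (c p)) ((c p).symm p) :=
      ((Complex.continuous_ofReal.continuousAt.comp
        ((ρ ∘L imJL).continuous.continuousAt.comp hn)).add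
        ((Complex.continuous_ofReal.continuousAt.comp
          ((ρ ∘L imKL).continuous.continuousAt.comp hn)).mul continuousAt_const)).pow 2
    refine (ContinuousAt.comp (f := (c p).symm) h1
      ((c p).continuousAt_symm (hc p))).congr ?_
    filter_upwards [(c p).open_target.mem_nhds (hc p)] with q hq
    rw [Function.comp_apply, hZ (c p) (hca p) _ ((c p).map_target hq), (c p).right_inv hq]
  have hZ1 : ∀ p, ‖Z p‖ = 1 := by
    intro p
    have h := (hG.chartLogDeriv_eq (hca p) ((c p).map_target (hc p))).2
    have h2 := congrArg ρ h
    rw [map_add, hρ, hρ, hρ1] at h2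
    simp only [Z, directionSq]
    rw [norm_pow, Complex.norm_add_mul_I, Real.sq_sqrt (by positivity)]
    linear_combination h2
  obtain ⟨Φ, hΦ, hΦZ⟩ := exists_continuous_arg hZc hZ1
  exact ⟨Φ, hΦ, fun a ha z hz => by rw [hZ a ha z hz, hΦZ]⟩

/-- The formula for `dψ` is stated as `ρ` of one Lorentz-valued expression so that the angles
obtained from `plus` and `minus` recombine. -/
theorem IsGaussSpinor.exists_angle (hG : IsGaussSpinor g G)
    [SimplyConnectedSpace M]
    (hch : ∀ p, ∃ a : OpenPartialHomeomorph LorentzNum M, p ∈ a.target ∧ IsArcLengthChart o g a)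
    {ρ : LorentzNum →L[ℝ] ℝ} (hρ : ∀ a b, ρ (a * b) = ρ a * ρ b) (hρ1 : ρ 1 = 1)
    {a : OpenPartialHomeomorph LorentzNum M} (ha : IsArcLengthChart o g a) :
    ∃ ψ : LorentzNum → ℝ, ContDiffOn ℝ ∞ ψ a.source ∧ (∀ z ∈ a.source,
        ρ (chartLogDeriv g a z).imJ = Real.cos (ψ z) ∧
        ρ (chartLogDeriv g a z).imK = Real.sin (ψ z)) ∧
      ∀ z ∈ a.source, ∀ h, fderiv ℝ ψ z h =
        ρ ((chartLogDeriv g a z).imJ * (fderiv ℝ (chartLogDeriv g a) z h).imK -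
          (chartLogDeriv g a z).imK * (fderiv ℝ (chartLogDeriv g a) z h).imJ) := by
  obtain ⟨Φ, hΦ, hΦe⟩ := hG.exists_double_angle hch hρ hρ1
  have hn := ha.contDiffOn_chartLogDeriv hG.smooth
  obtain ⟨ψ, h1, h2, h3⟩ := exists_contDiffOn_angle a.open_source
    (β := fun z => (ρ ∘L imJL) (chartLogDeriv g a z))
    (γ := fun z => (ρ ∘L imKL) (chartLogDeriv g a z))
    ((ρ ∘L imJL).contDiff.comp_contDiffOn hn) ((ρ ∘L imKL).contDiff.comp_contDiffOn hn)
    (Φ := Φ ∘ a) (hΦ.comp_continuousOn a.continuousOn) (hΦe a ha)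
  refine ⟨ψ, h1, h2, fun z hz h => ?_⟩
  have hd := ((hn.contDiffAt (a.open_source.mem_nhds hz)).differentiableAt (by simp)).hasFDerivAt
  have e1 : HasFDerivAt (fun z => (ρ ∘L imJL) (chartLogDeriv g a z)) _ z :=
    (ρ ∘L imJL).hasFDerivAt.comp z hd
  have e2 : HasFDerivAt (fun z => (ρ ∘L imKL) (chartLogDeriv g a z)) _ z :=
    (ρ ∘L imKL).hasFDerivAt.comp z hd
  rw [h3 z hz h, e1.fderiv, e2.fderiv, map_sub, hρ, hρ]
  rfl

/-- In an arc length chart, `g' g⁻¹ = cos ψ J + sin ψ K` for a conformal map `ψ`. -/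
theorem IsGaussSpinor.exists_conformal_angle (hG : IsGaussSpinor g G)
    [SimplyConnectedSpace M]
    (hch : ∀ p, ∃ a : OpenPartialHomeomorph LorentzNum M, p ∈ a.target ∧ IsArcLengthChart o g a)
    {a : OpenPartialHomeomorph LorentzNum M} (ha : IsArcLengthChart o g a) :
    ∃ ψ : LorentzNum → LorentzNum, ContDiffOn ℝ ∞ ψ a.source ∧
      ∀ z ∈ a.source, (∀ h, fderiv ℝ ψ z (lsig * h) = lsig * fderiv ℝ ψ z h) ∧
        lorentzDeriv (g ∘ a) z * Ring.inverse (g (a z)) =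
          lcos (ψ z) • qJ + lsin (ψ z) • qK := by
  obtain ⟨ψ₁, hψ₁, hcs₁, hd₁⟩ := hG.exists_angle hch LorentzNum.plus_mul LorentzNum.plus_one ha
  obtain ⟨ψ₂, hψ₂, hcs₂, hd₂⟩ := hG.exists_angle hch LorentzNum.minus_mul LorentzNum.minus_one ha
  refine ⟨fun z => LorentzNum.ofPair (ψ₁ z, ψ₂ z),
    LorentzNum.ofPair.contDiff.comp_contDiffOn (hψ₁.prodMk hψ₂), fun z hz => ⟨?_, ?_⟩⟩
  · have h1 : HasFDerivAt (fun z => LorentzNum.ofPair (ψ₁ z, ψ₂ z)) _ z :=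
      LorentzNum.ofPair.hasFDerivAt.comp z
        (((hψ₁.contDiffAt (a.open_source.mem_nhds hz)).differentiableAt (by simp)).hasFDerivAt.prodMk
        ((hψ₂.contDiffAt (a.open_source.mem_nhds hz)).differentiableAt (by simp)).hasFDerivAt)
    -- This is `dψ = β dγ - γ dβ` over the Lorentz numbers; its right-hand side commutes with `σ` by
    -- `fderiv_chartLogDeriv`.
    have h2 : ∀ h, fderiv ℝ (fun z => LorentzNum.ofPair (ψ₁ z, ψ₂ z)) z h =
        (chartLogDeriv g a z).imJ * (fderiv ℝ (chartLogDeriv g a) z h).imK -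
          (chartLogDeriv g a z).imK * (fderiv ℝ (chartLogDeriv g a) z h).imJ := by
      intro h
      rw [h1.fderiv]
      apply LorentzNum.ext_plus_minus
      · rw [← hd₁ z hz h]; exact LorentzNum.plus_ofPair _
      · rw [← hd₂ z hz h]; exact LorentzNum.minus_ofPair _
    intro h
    rw [h2, h2, ha.fderiv_chartLogDeriv hG.smooth hz, ha.fderiv_chartLogDeriv hG.smooth hz h]
    have e : ∀ (b : LorentzNum) (q : LorentzQuat), (b • q).imJ = b * q.imJ ∧
        (b • q).imK = b * q.imK := fun b q => ⟨rfl, rfl⟩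
    rw [(e _ _).1, (e _ _).1, (e _ _).2, (e _ _).2]
    ring
  · rw [inverse_of_formH (hG.formH_eq_one _)]
    change chartLogDeriv g a z = _
    rw [(hG.chartLogDeriv_eq ha hz).1]
    congr 2
    · apply LorentzNum.ext_plus_minus
      · rw [LorentzNum.plus_lcos, LorentzNum.plus_ofPair, (hcs₁ z hz).1]
      · rw [LorentzNum.minus_lcos, LorentzNum.minus_ofPair, (hcs₂ z hz).1]
    · apply LorentzNum.ext_plus_minus
      · rw [LorentzNum.plus_lsin, LorentzNum.plus_ofPair, (hcs₁ z hz).2]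
      · rw [LorentzNum.minus_lsin, LorentzNum.minus_ofPair, (hcs₂ z hz).2]

end Direction

end

/-! ### The theorem: global Lorentz structure and assembly -/

theorem mainTheorem4 {M : Type*} [TopologicalSpace M] [T2Space M] [SecondCountableTopology M]
    [ChartedSpace R2 M] [IsManifold 𝓘(ℝ, R2) ∞ M] [SimplyConnectedSpace M]
    (o : SurfaceOrientation M) (F : M → R4) (hF : IsSmoothImmersion F)
    (e : Fin 4 → M → R4) (he : IsParallelFrame o F e)
    (G : M → Bivec) (hG : IsGaussMap o F G)
    (hreg : ∀ p, Function.Injective (mfderiv 𝓘(ℝ, R2) 𝓘(ℝ, Bivec) G p))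
    (g : M → LorentzQuat) (hg : RepresentsConstSpinor e g) :
    ∃ S : LorentzStructure M, S.IsInducedBy G ∧
      (∀ S' : LorentzStructure M, S'.IsInducedBy G → S' = S) ∧
      -- `g` is a conformal map into the unit sphere
      (∀ p, formH (g p) (g p) = 1) ∧ S.IsConformal g ∧
      -- arc length charts: existence, compatibility with the Lorentz structure
      (∀ p, ∃ a : OpenPartialHomeomorph LorentzNum M, p ∈ a.target ∧ IsArcLengthChart o g a) ∧
      (∀ a : OpenPartialHomeomorph LorentzNum M, IsArcLengthChart o g a →
        IsCompatibleChart S.toFun a) ∧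
      -- two such charts differ by a map `z ↦ ± z + b` on every connected part of their overlap
      (∀ a₁ a₂ : OpenPartialHomeomorph LorentzNum M,
        IsArcLengthChart o g a₁ → IsArcLengthChart o g a₂ →
        ∀ C : Set M, C ⊆ a₁.target ∩ a₂.target → IsPreconnected C →
          ∃ ε b : LorentzNum, (ε = 1 ∨ ε = -1) ∧ ∀ p ∈ C, a₂.symm p = ε * a₁.symm p + b) ∧
      -- and every chart obtained from such a chart by a map `z ↦ ± z + b` is again one
      (∀ a₁ a₂ : OpenPartialHomeomorph LorentzNum M, IsArcLengthChart o g a₁ →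
        a₂.target ⊆ a₁.target →
        (∃ ε b : LorentzNum, (ε = 1 ∨ ε = -1) ∧
          ∀ p ∈ a₂.target, a₂.symm p = ε * a₁.symm p + b) →
        IsArcLengthChart o g a₂) ∧
      -- in each such chart, `g' g⁻¹ = cos ψ J + sin ψ K` for a conformal map `ψ`
      (∀ a : OpenPartialHomeomorph LorentzNum M, IsArcLengthChart o g a →
        ∃ ψ : LorentzNum → LorentzNum, ContDiffOn ℝ ∞ ψ a.source ∧
          ∀ z ∈ a.source, (∀ h, fderiv ℝ ψ z (lsig * h) = lsig * fderiv ℝ ψ z h) ∧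
            lorentzDeriv (g ∘ a) z * Ring.inverse (g (a z)) =
              lcos (ψ z) • qJ + lsin (ψ z) • qK) := by
  have hs := isGaussSpinor_of_frame o F e he G hG g hg
  have hinj : ∀ p, Function.Injective (mfderiv 𝓘(ℝ, R2) 𝓘(ℝ, LorentzQuat) g p) := fun p =>
    hs.injective (hreg p)
  have hch := hs.exists_isArcLengthChart hinj o
  have hT : ∀ p, ∃ T : R2 →ₗ[ℝ] R2, ∀ u, surfDeriv g p (T u) = lsig • surfDeriv g p u := fun p =>
    let ⟨_, hp, ha⟩ := hch p
    exists_endomorphism ha hs.smooth hp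
  -- The endomorphisms are chosen point by point, yet `dg (T u) = σ dg u` determines them because
  -- `dg` is injective. This gives compatibility with every arc length chart, and also uniqueness.
  choose T hT using hT
  have hcompat : ∀ a : OpenPartialHomeomorph LorentzNum M, IsArcLengthChart o g a →
      IsCompatibleChart (fun p => (T p : TangentSpace 𝓘(ℝ, R2) p →ₗ[ℝ] TangentSpace 𝓘(ℝ, R2) p))
        a := by
    refine fun a ha => ⟨ha.1, fun z hz h => hinj (a z) ?_⟩
    change surfDeriv g (a z) (T (a z) (chartMap a z h)) =
      surfDeriv g (a z) (chartMap a z (lsig * h))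
    rw [hT, ha.surfDeriv_chartMap hs.smooth hz, ha.surfDeriv_chartMap hs.smooth hz, smul_smul]
  refine ⟨⟨fun p => T p, fun p => ?_⟩, ?_, ?_, hs.formH_eq_one, ⟨hs.smooth, hT⟩, hch, hcompat,
    fun a₁ a₂ h₁ h₂ C hC hCc => h₁.exists_affine h₂ hs.smooth hC hCc, ?_,
    fun a ha => hs.exists_conformal_angle hch ha⟩
  · obtain ⟨a, hp, ha⟩ := hch p
    exact ⟨a, hp, hcompat a ha⟩
  · exact fun p u => (hs.hodge_iff p u (T p u)).2 (hT p u)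
  · refine fun S' hS' => LorentzStructure.eq_of_toFun ?_
    funext p
    refine LinearMap.ext fun u => hinj p ?_
    exact ((hs.hodge_iff p u (S'.toFun p u)).1 (hS' p u)).trans (hT p u).symm
  · rintro a₁ a₂ h₁ ht ⟨ε, b, hε, h⟩
    -- The Lorentz number `±1` is replaced by a real sign, the form expected by `of_affine`.
    obtain ⟨s, hss, rfl⟩ : ∃ s : ℝ, s * s = 1 ∧ s • (1 : LorentzNum) = ε := by
      rcases hε with rfl | rfl
      · exact ⟨1, by norm_num, one_smul _ _⟩
      · exact ⟨-1, by norm_num, by rw [neg_smul, one_smul]⟩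
    exact h₁.of_affine ht hss fun p hp => by rw [h p hp, ← smul_eq_mul_of_sign]
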